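/- \textbf{Setting.} Let $D$ be an integral domain with quotient field $K$ and let $\operatorname{Int}(D)=\{f\in K[X]: f(D)\subseteq D\}$. All algebras are commutative with $1$. A $D$-$D$-biring is a $D$-algebra $S$ with the structure of a $D$-algebra object in the opposite of the category of $D$-algebras (co-addition, co-multiplication, co-additive inverse, co-$D$-linear structure $\beta:D\to\operatorname{Hom}_D(S,D)$); then $W_S(A)=\operatorname{Hom}_D(S,A)$ is a $D$-algebra, functorially in the $D$-algebra $A$. The $D$-algebra $S\odot_D A$ is generated by symbols $s\odot a$ ($s\in S$, $a\in A$), subject to the relations saying that $s\mapsto s\odot a$ is a $D$-algebra homomorphism for each $a$, and $s\odot(a+a')=\sum_i(s^+_{i1}\odot a)(s^+_{i2}\odot a')$, $s\odot(aa')=\sum_i(s^\times_{i1}\odot a)(s^\times_{i2}\odot a')$, $s\odot c=\beta(c)(s)$ for $c\in D$, where $\sum_i s^+_{i1}\otimes s^+_{i2}$ and $\sum_i s^\times_{i1}\otimes s^\times_{i2}$ are the co-sum and co-product of $s$. A $D$-plethory is a monoid object $P$ (composition $\circ:P\odot_D P\to P$, unit $D[X]\to P$) in the category of $D$-$D$-birings,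 monoidal under $\odot_D$ with unit object $D[X]$. A $P$-ring is a $D$-algebra $R$ with a $D$-algebra homomorphism $\circ: P\odot_D R\to R$ such that $(\alpha\circ\beta)\circ r=\alpha\circ(\beta\circ r)$ and $e\circ r=r$, where $e$ is the image of $X$ under the unit of $P$. A $D$-algebra $A$ is \emph{WPC} if for every $a\in A$ there is a $D$-algebra homomorphism $\operatorname{Int}(D)\to A$ sending $X$ to $a$. For a $D$-torsion-free $D$-algebra $A$ let $w^D(A)$ be the compositum of all WPC $D$-subalgebras of $A$, and let $w_D(A)$ be the intersection of all WPC $D$-subalgebras of $A\otimes_D K$ that contain $A$; both are functorial in $A$. For any $D$-algebra $B$ let $T(B)$ be the image of $B$ in $B\otimes_D K$. For a set $\mathbf X$ let $\operatorname{Int}_\otimes(D^{\mathbf X})\subseteq K[\mathbf X]$ be the $D$-algebra generated by all $f(x)$ with $f\in \operatorname{Int}(D)$, $x\in\mathbf X$, and $\operatorname{Int}_{\mathrm w}(D^{\mathbf X})$ the smallest subring of $K[\mathbf X]$ that contains $D[\mathbf X]$ and contains $f(g)$ for all its elements $g$ and all $f\in\operatorname{Int}(D)$; $D$ is \emph{weakly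 polynomially composite} if the two coincide for every set $\mathbf X$. \textbf{Theorem.} If $\operatorname{Int}(D)^{\otimes n}$ is $D$-torsion-free for all $n\le 4$ and $D$ is weakly polynomially composite, then $\operatorname{Int}(D)$ has a $D$-plethory structure with unit the inclusion $D[X]\to\operatorname{Int}(D)$. Suppose that $\operatorname{Int}(D)$ has a $D$-plethory structure with unit the inclusion $D[X]\to\operatorname{Int}(D)$, and write $W=W_{\operatorname{Int}(D)}$ for the resulting functor $\operatorname{Hom}_D(\operatorname{Int}(D),-)$. Let $A$ be a $D$-algebra. \begin{enumerate} \item If $A$ has an $\operatorname{Int}(D)$-ring structure, then $A$ is WPC. \item If $A$ is $D$-torsion-free, then $A$ has at most one $\operatorname{Int}(D)$-ring structure, and it has one if and only if $A$ is WPC. \item $W(A)$ and $\operatorname{Int}(D)\odot_D A$ have $\operatorname{Int}(D)$-ring structures, hence are WPC. \item If $A$ is $D$-torsion-free, then $w^D(A)$ is the largest WPC $D$-subalgebra of $A$, and $\varphi\mapsto\varphi(X)$ is an injective $D$-algebra homomorphism $W(A)\to A$ with image $w^D(A)$; these maps give an isomorphism of functors from $W$, restricted to $D$-torsion-free $D$-algebras,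 to $w^D$. \item If $A$ is $D$-torsion-free, then $w_D(A)$ is the smallest WPC $D$-subalgebra of $A\otimes_D K$ containing $A$, and there is a $D$-algebra homomorphism $\operatorname{Int}(D)\odot_D A\to A\otimes_D K$, $f\odot a\mapsto f(a)$, with image $w_D(A)$; these maps induce an isomorphism of functors from $T\circ(\operatorname{Int}(D)\odot_D-)$, restricted to $D$-torsion-free $D$-algebras, to $w_D$. \item If $A$ is $D$-torsion-free and WPC, then the $D$-algebra homomorphisms $W(A)\to A$, $\varphi\mapsto\varphi(X)$, and $A\to T(\operatorname{Int}(D)\odot_D A)$, $a\mapsto X\odot a$, are isomorphisms. \item $T\circ(\operatorname{Int}(D)\odot_D-)$ takes values in the $D$-torsion-free WPC $D$-algebras and is a left adjoint of the inclusion of the category of these into that of all $D$-algebras. \item The functors $W$ and $\operatorname{Int}(D)\odot_D-$ take values in the $D$-torsion-free WPC $D$-algebras and are right and left adjoints, respectively, of the inclusion of these into all $D$-algebras if and only if $W(R)$ and $\operatorname{Int}(D)\odot_D R$ are $D$-torsion-free for every $D$-algebra $R$. \item If $D$ is a PID with finite residue fields, then every $\operatorname{Int}(D)$-ring is $D$-torsion-free,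 and therefore $W$ and $\operatorname{Int}(D)\odot_D-$ are right and left adjoints, respectively, of the inclusion of the $D$-torsion-free WPC $D$-algebras into all $D$-algebras. \end{enumerate} -/

import Mathlib

open CategoryTheory TensorProduct

universe u

noncomputable section

namespace Pleth

/-! ### Birings -/

section Conv

variable {A S R R' : Type*} [CommRing A] [CommRing S] [Algebra A S] [CommRing R] [Algebra A R]
  [CommRing R'] [Algebra A R']

/-- The binary operation on `Hom_A(S, R)` induced by a binary co-operation `m : S → S ⊗ S`:
if `m s = ∑ sᵢ₁ ⊗ sᵢ₂`, then `conv m φ ψ s = ∑ φ sᵢ₁ * ψ sᵢ₂`. -/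
def conv (m : S →ₐ[A] S ⊗[A] S) (φ ψ : S →ₐ[A] R) : S →ₐ[A] R :=
  (Algebra.TensorProduct.productMap φ ψ).comp m

theorem comp_conv (m : S →ₐ[A] S ⊗[A] S) (f : R →ₐ[A] R') (φ ψ : S →ₐ[A] R) :
    f.comp (conv m φ ψ) = conv m (f.comp φ) (f.comp ψ) := by
  unfold conv
  rw [← AlgHom.comp_assoc]
  congr 1
  ext <;> simp

variable (A S)

/-- The coprojections `S → S ⊗ S ⊗ S`. -/
def in₁ : S →ₐ[A] S ⊗[A] (S ⊗[A] S) := Algebra.TensorProduct.includeLeft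

/-- See `in₁`. -/
def in₂ : S →ₐ[A] S ⊗[A] (S ⊗[A] S) :=
  Algebra.TensorProduct.includeRight.comp Algebra.TensorProduct.includeLeft

/-- See `in₁`. -/
def in₃ : S →ₐ[A] S ⊗[A] (S ⊗[A] S) :=
  Algebra.TensorProduct.includeRight.comp Algebra.TensorProduct.includeRight

/-- The unit map `A → R` as an `A`-algebra homomorphism. -/
abbrev unitHom (R : Type*) [CommRing R] [Algebra A R] : A →ₐ[A] R := Algebra.ofId A R

end Conv

/-- An `A`-`A`-biring structure on the `A`-algebra `S`: an `A`-algebra object structure in the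
opposite of the category of `A`-algebras. The co-operations are co-addition `coadd`,
co-multiplication `comul`, the co-additive inverse `coneg` and the co-`A`-linear structure
`colin : A → Hom_A(S, A)`; the co-zero is `colin 0` and the co-unit is `colin 1`.
The laws are dual to those of commutative `A`-algebras. For instance `coadd_assoc` is an equality
of two maps `S → S ⊗ S ⊗ S`, namely `(coadd ⊗ id) ∘ coadd = (id ⊗ coadd) ∘ coadd`. -/
structure Biring (A S : Type*) [CommRing A] [CommRing S] [Algebra A S] where
  coadd : S →ₐ[A] S ⊗[A] S
  comul : S →ₐ[A] S ⊗[A] S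
  coneg : S →ₐ[A] S
  colin : A → (S →ₐ[A] A)
  coadd_assoc : conv coadd (conv coadd (in₁ A S) (in₂ A S)) (in₃ A S) =
    conv coadd (in₁ A S) (conv coadd (in₂ A S) (in₃ A S))
  coadd_comm : (Algebra.TensorProduct.comm A S S).toAlgHom.comp coadd = coadd
  coadd_zero : conv coadd ((unitHom A S).comp (colin 0)) (AlgHom.id A S) = AlgHom.id A S
  coadd_neg : conv coadd coneg (AlgHom.id A S) = (unitHom A S).comp (colin 0)
  comul_assoc : conv comul (conv comul (in₁ A S) (in₂ A S)) (in₃ A S) =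
    conv comul (in₁ A S) (conv comul (in₂ A S) (in₃ A S))
  comul_comm : (Algebra.TensorProduct.comm A S S).toAlgHom.comp comul = comul
  comul_one : conv comul ((unitHom A S).comp (colin 1)) (AlgHom.id A S) = AlgHom.id A S
  codistrib : conv comul (in₁ A S) (conv coadd (in₂ A S) (in₃ A S)) =
    conv coadd (conv comul (in₁ A S) (in₂ A S)) (conv comul (in₁ A S) (in₃ A S))
  colin_add : ∀ a b, colin (a + b) = conv coadd (colin a) (colin b)
  colin_mul : ∀ a b, colin (a * b) = conv comul (colin a) (colin b)

/-- Homomorphisms of `A`-`A`-birings: `A`-algebra homomorphisms that respect co-addition,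
co-multiplication and the co-`A`-linear structure. -/
structure IsBiringHom {A S T : Type*} [CommRing A] [CommRing S] [Algebra A S] [CommRing T]
    [Algebra A T] (𝒮 : Biring A S) (𝒯 : Biring A T) (f : S →ₐ[A] T) : Prop where
  map_coadd : (Algebra.TensorProduct.map f f).comp 𝒮.coadd = 𝒯.coadd.comp f
  map_comul : (Algebra.TensorProduct.map f f).comp 𝒮.comul = 𝒯.comul.comp f
  map_colin : ∀ a, (𝒯.colin a).comp f = 𝒮.colin a

/-! ### The functor `Hom_A(S, -)` with values in `A`-algebras -/

/-- The set `W_S(R) = Hom_A(S, R)`, on which the biring structure of `S` induces the structure of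
an `A`-algebra. -/
def Witt {A S : Type*} [CommRing A] [CommRing S] [Algebra A S] (_ : Biring A S)
    (R : Type*) [CommRing R] [Algebra A R] : Type _ := S →ₐ[A] R

section Witt

variable {A S R R' R'' : Type*} [CommRing A] [CommRing S] [Algebra A S] (𝒮 : Biring A S)
  [CommRing R] [Algebra A R] [CommRing R'] [Algebra A R'] [CommRing R''] [Algebra A R'']

namespace Witt

variable {𝒮} in
/-- An element of `W_S(R)` from an algebra homomorphism `S → R`. -/
def of (φ : S →ₐ[A] R) : Witt 𝒮 R := φ

variable {𝒮} in
/-- The algebra homomorphism `S → R` that an element of `W_S(R)` is. -/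
def hom (φ : Witt 𝒮 R) : S →ₐ[A] R := φ

variable {𝒮} in
theorem hom_injective {φ ψ : Witt 𝒮 R} (h : φ.hom = ψ.hom) : φ = ψ := h

instance : Add (Witt 𝒮 R) := ⟨fun φ ψ => of (conv 𝒮.coadd φ.hom ψ.hom)⟩
instance : Mul (Witt 𝒮 R) := ⟨fun φ ψ => of (conv 𝒮.comul φ.hom ψ.hom)⟩
instance : Neg (Witt 𝒮 R) := ⟨fun φ => of (φ.hom.comp 𝒮.coneg)⟩
instance : Zero (Witt 𝒮 R) := ⟨of ((unitHom A R).comp (𝒮.colin 0))⟩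
instance : One (Witt 𝒮 R) := ⟨of ((unitHom A R).comp (𝒮.colin 1))⟩

theorem hom_add (φ ψ : Witt 𝒮 R) : (φ + ψ).hom = conv 𝒮.coadd φ.hom ψ.hom := rfl
theorem hom_mul (φ ψ : Witt 𝒮 R) : (φ * ψ).hom = conv 𝒮.comul φ.hom ψ.hom := rfl
theorem hom_neg (φ : Witt 𝒮 R) : (-φ).hom = φ.hom.comp 𝒮.coneg := rfl
theorem hom_zero : (0 : Witt 𝒮 R).hom = (unitHom A R).comp (𝒮.colin 0) := rfl
theorem hom_one : (1 : Witt 𝒮 R).hom = (unitHom A R).comp (𝒮.colin 1) := rfl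

/-- The map `S ⊗ S ⊗ S → R` with given components. -/
def triple (φ ψ χ : S →ₐ[A] R) : S ⊗[A] (S ⊗[A] S) →ₐ[A] R :=
  Algebra.TensorProduct.productMap φ (Algebra.TensorProduct.productMap ψ χ)

theorem triple_in₁ (φ ψ χ : S →ₐ[A] R) : (triple φ ψ χ).comp (in₁ A S) = φ := by
  ext; simp [triple, in₁]
theorem triple_in₂ (φ ψ χ : S →ₐ[A] R) : (triple φ ψ χ).comp (in₂ A S) = ψ := by
  ext; simp [triple, in₂]
theorem triple_in₃ (φ ψ χ : S →ₐ[A] R) : (triple φ ψ χ).comp (in₃ A S) = χ := by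
  ext; simp [triple, in₃]

theorem conv_swap (m : S →ₐ[A] S ⊗[A] S)
    (h : (Algebra.TensorProduct.comm A S S).toAlgHom.comp m = m) (φ ψ : S →ₐ[A] R) :
    conv m φ ψ = conv m ψ φ := by
  unfold conv
  conv_rhs => rw [← h]
  rw [← AlgHom.comp_assoc]
  congr 1
  ext <;> simp

theorem comp_unitHom (f : R →ₐ[A] R') : f.comp (unitHom A R) = unitHom A R' := by
  ext

theorem add_assoc' (φ ψ χ : Witt 𝒮 R) : φ + ψ + χ = φ + (ψ + χ) := by
  have h := congrArg (fun f => (triple φ.hom ψ.hom χ.hom).comp f) 𝒮.coadd_assoc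
  simp only [comp_conv, triple_in₁, triple_in₂, triple_in₃] at h
  exact h

theorem mul_assoc' (φ ψ χ : Witt 𝒮 R) : φ * ψ * χ = φ * (ψ * χ) := by
  have h := congrArg (fun f => (triple φ.hom ψ.hom χ.hom).comp f) 𝒮.comul_assoc
  simp only [comp_conv, triple_in₁, triple_in₂, triple_in₃] at h
  exact h

theorem mul_add' (φ ψ χ : Witt 𝒮 R) : φ * (ψ + χ) = φ * ψ + φ * χ := by
  have h := congrArg (fun f => (triple φ.hom ψ.hom χ.hom).comp f) 𝒮.codistrib
  simp only [comp_conv, triple_in₁, triple_in₂, triple_in₃] at h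
  exact h

theorem add_comm' (φ ψ : Witt 𝒮 R) : φ + ψ = ψ + φ := conv_swap _ 𝒮.coadd_comm _ _

theorem mul_comm' (φ ψ : Witt 𝒮 R) : φ * ψ = ψ * φ := conv_swap _ 𝒮.comul_comm _ _

theorem zero_add' (φ : Witt 𝒮 R) : 0 + φ = φ := by
  have h := congrArg (fun f => φ.hom.comp f) 𝒮.coadd_zero
  simp only [comp_conv, ← AlgHom.comp_assoc, comp_unitHom, AlgHom.comp_id] at h
  exact h

theorem one_mul' (φ : Witt 𝒮 R) : 1 * φ = φ := by
  have h := congrArg (fun f => φ.hom.comp f) 𝒮.comul_one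
  simp only [comp_conv, ← AlgHom.comp_assoc, comp_unitHom, AlgHom.comp_id] at h
  exact h

theorem neg_add' (φ : Witt 𝒮 R) : -φ + φ = 0 := by
  have h := congrArg (fun f => φ.hom.comp f) 𝒮.coadd_neg
  simp only [comp_conv, ← AlgHom.comp_assoc, comp_unitHom, AlgHom.comp_id] at h
  exact h

theorem zero_mul' (φ : Witt 𝒮 R) : 0 * φ = 0 := by
  have h : φ * 0 + φ * 0 = φ * 0 := by rw [← mul_add', zero_add']
  have h2 : -(φ * 0) + (φ * 0 + φ * 0) = -(φ * 0) + φ * 0 := by rw [h]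
  rw [← add_assoc', neg_add', zero_add'] at h2
  rw [mul_comm', h2]

instance : CommRing (Witt 𝒮 R) where
  add_assoc := add_assoc' 𝒮
  zero_add := zero_add' 𝒮
  add_zero φ := by rw [add_comm', zero_add']
  add_comm := add_comm' 𝒮
  nsmul := nsmulRec
  zsmul := zsmulRec
  neg_add_cancel := neg_add' 𝒮
  mul_assoc := mul_assoc' 𝒮
  one_mul := one_mul' 𝒮
  mul_one φ := by rw [mul_comm', one_mul']
  mul_comm := mul_comm' 𝒮
  left_distrib := mul_add' 𝒮
  right_distrib φ ψ χ := by rw [mul_comm', mul_add', mul_comm' 𝒮 χ, mul_comm' 𝒮 χ]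
  zero_mul := zero_mul' 𝒮
  mul_zero φ := by rw [mul_comm', zero_mul']

instance : Algebra A (Witt 𝒮 R) :=
  RingHom.toAlgebra
    { toFun := fun a => of ((unitHom A R).comp (𝒮.colin a))
      map_one' := rfl
      map_zero' := rfl
      map_add' := fun a b => by
        change (unitHom A R).comp (𝒮.colin (a + b)) = conv 𝒮.coadd _ _
        rw [𝒮.colin_add, comp_conv]
        rfl
      map_mul' := fun a b => by
        change (unitHom A R).comp (𝒮.colin (a * b)) = conv 𝒮.comul _ _
        rw [𝒮.colin_mul, comp_conv]
        rfl }

theorem hom_algebraMap (a : A) :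
    (algebraMap A (Witt 𝒮 R) a).hom = (unitHom A R).comp (𝒮.colin a) := rfl

/-- Functoriality of `W_S`: post-composition. -/
def map (f : R →ₐ[A] R') : Witt 𝒮 R →ₐ[A] Witt 𝒮 R' where
  toFun φ := of (f.comp φ.hom)
  map_one' := by
    apply hom_injective
    change f.comp ((unitHom A R).comp _) = (unitHom A R').comp _
    rw [← AlgHom.comp_assoc, comp_unitHom]
  map_mul' φ ψ := comp_conv _ _ _ _
  map_zero' := by
    apply hom_injective
    change f.comp ((unitHom A R).comp _) = (unitHom A R').comp _
    rw [← AlgHom.comp_assoc, comp_unitHom]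
  map_add' φ ψ := comp_conv _ _ _ _
  commutes' a := by
    apply hom_injective
    change f.comp ((unitHom A R).comp _) = (unitHom A R').comp _
    rw [← AlgHom.comp_assoc, comp_unitHom]

theorem hom_map (f : R →ₐ[A] R') (φ : Witt 𝒮 R) : (map 𝒮 f φ).hom = f.comp φ.hom := rfl

end Witt

end Witt

/-! ### The composition product `S ⊙ R` -/

section Odot

variable {A S : Type*} [CommRing A] [CommRing S] [Algebra A S]

/-- The defining relations of `S ⊙ R` on the free commutative `A`-algebra on the symbols
`s ⊙ r`. In `right_add` (and likewise in `right_mul`) the list `l` is any expression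
`∑ sᵢ₁ ⊗ sᵢ₂` of `coadd s` as a sum of pure tensors. -/
inductive OdotRel (𝒮 : Biring A S) (R : Type*) [CommRing R] [Algebra A R] :
    MvPolynomial (S × R) A → MvPolynomial (S × R) A → Prop
  | left_add (s s' : S) (r : R) : OdotRel 𝒮 R (MvPolynomial.X (s + s', r))
      (MvPolynomial.X (s, r) + MvPolynomial.X (s', r))
  | left_mul (s s' : S) (r : R) : OdotRel 𝒮 R (MvPolynomial.X (s * s', r))
      (MvPolynomial.X (s, r) * MvPolynomial.X (s', r))
  | left_scalar (c : A) (r : R) : OdotRel 𝒮 R (MvPolynomial.X (algebraMap A S c, r))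
      (MvPolynomial.C c)
  | right_add (s : S) (r r' : R) (l : List (S × S))
      (hl : 𝒮.coadd s = (l.map fun p => p.1 ⊗ₜ[A] p.2).sum) :
      OdotRel 𝒮 R (MvPolynomial.X (s, r + r'))
        (l.map fun p => MvPolynomial.X (p.1, r) * MvPolynomial.X (p.2, r')).sum
  | right_mul (s : S) (r r' : R) (l : List (S × S))
      (hl : 𝒮.comul s = (l.map fun p => p.1 ⊗ₜ[A] p.2).sum) :
      OdotRel 𝒮 R (MvPolynomial.X (s, r * r'))
        (l.map fun p => MvPolynomial.X (p.1, r) * MvPolynomial.X (p.2, r')).sum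
  | right_scalar (s : S) (c : A) : OdotRel 𝒮 R (MvPolynomial.X (s, algebraMap A R c))
      (MvPolynomial.C (𝒮.colin c s))

/-- The composition product `S ⊙ R`, for an `A`-`A`-biring `S` and an `A`-algebra `R`. -/
def Odot (𝒮 : Biring A S) (R : Type*) [CommRing R] [Algebra A R] : Type _ :=
  RingQuot (OdotRel 𝒮 R)

namespace Odot

variable (𝒮 : Biring A S) {R R' B B' : Type*} [CommRing R] [Algebra A R]
  [CommRing R'] [Algebra A R'] [CommRing B] [Algebra A B] [CommRing B'] [Algebra A B']

instance : CommRing (Odot 𝒮 R) := inferInstanceAs (CommRing (RingQuot (OdotRel 𝒮 R)))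
instance : Algebra A (Odot 𝒮 R) := inferInstanceAs (Algebra A (RingQuot (OdotRel 𝒮 R)))

/-- The quotient map from the free algebra on the symbols `s ⊙ r`. -/
def proj : MvPolynomial (S × R) A →ₐ[A] Odot 𝒮 R := RingQuot.mkAlgHom A (OdotRel 𝒮 R)

/-- The element `s ⊙ r` of `S ⊙ R`. -/
def mk (s : S) (r : R) : Odot 𝒮 R := proj 𝒮 (MvPolynomial.X (s, r))

variable {𝒮} in
theorem proj_rel {x y : MvPolynomial (S × R) A} (h : OdotRel 𝒮 R x y) :
    proj 𝒮 x = proj 𝒮 y := RingQuot.mkAlgHom_rel A h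

theorem hom_ext {f g : Odot 𝒮 R →ₐ[A] B} (h : ∀ s r, f (mk 𝒮 s r) = g (mk 𝒮 s r)) : f = g := by
  apply RingQuot.ringQuot_ext'
  apply MvPolynomial.algHom_ext
  rintro ⟨s, r⟩
  exact h s r

/-- For fixed `r`, the algebra homomorphism `s ↦ s ⊙ r`. -/
def mkHom (r : R) : S →ₐ[A] Odot 𝒮 R where
  toFun s := mk 𝒮 s r
  map_one' := by
    have h := proj_rel (OdotRel.left_scalar (𝒮 := 𝒮) 1 r)
    rwa [map_one, map_one, map_one] at h
  map_mul' s s' := by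
    have h := proj_rel (OdotRel.left_mul (𝒮 := 𝒮) s s' r)
    rwa [map_mul] at h
  map_zero' := by
    have h := proj_rel (OdotRel.left_scalar (𝒮 := 𝒮) 0 r)
    rwa [map_zero, map_zero, map_zero] at h
  map_add' s s' := by
    have h := proj_rel (OdotRel.left_add (𝒮 := 𝒮) s s' r)
    rwa [map_add] at h
  commutes' c := by
    have h := proj_rel (OdotRel.left_scalar (𝒮 := 𝒮) c r)
    rw [← MvPolynomial.algebraMap_eq, AlgHom.commutes] at h
    exact h

theorem mkHom_apply (r : R) (s : S) : mkHom 𝒮 r s = mk 𝒮 s r := rfl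

theorem exists_list (t : S ⊗[A] S) :
    ∃ l : List (S × S), t = (l.map fun p => p.1 ⊗ₜ[A] p.2).sum := by
  induction t with
  | zero => exact ⟨[], by simp⟩
  | tmul x y => exact ⟨[(x, y)], by simp⟩
  | add x y hx hy =>
    obtain ⟨l, rfl⟩ := hx
    obtain ⟨l', rfl⟩ := hy
    exact ⟨l ++ l', by simp⟩

/-- The universal element: the algebra homomorphism `R → W_S(S ⊙ R)`, `r ↦ (s ↦ s ⊙ r)`. -/
def univ : R →ₐ[A] Witt 𝒮 (Odot 𝒮 R) :=
  have hadd : ∀ r r' : R, (mkHom 𝒮 (r + r') : S →ₐ[A] _) =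
      conv 𝒮.coadd (mkHom 𝒮 r) (mkHom 𝒮 r') := fun r r' => by
    ext s
    obtain ⟨l, hl⟩ := exists_list (𝒮.coadd s)
    have h := proj_rel (OdotRel.right_add (𝒮 := 𝒮) s r r' l hl)
    simp only [conv, AlgHom.comp_apply, hl, map_list_sum, List.map_map] at h ⊢
    refine Eq.trans h ?_
    congr 1
    apply List.map_congr_left
    intro p _
    simp [mkHom_apply, mk]
  have hmul : ∀ r r' : R, (mkHom 𝒮 (r * r') : S →ₐ[A] _) =
      conv 𝒮.comul (mkHom 𝒮 r) (mkHom 𝒮 r') := fun r r' => by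
    ext s
    obtain ⟨l, hl⟩ := exists_list (𝒮.comul s)
    have h := proj_rel (OdotRel.right_mul (𝒮 := 𝒮) s r r' l hl)
    simp only [conv, AlgHom.comp_apply, hl, map_list_sum, List.map_map] at h ⊢
    refine Eq.trans h ?_
    congr 1
    apply List.map_congr_left
    intro p _
    simp [mkHom_apply, mk]
  have hlin : ∀ c : A, (mkHom 𝒮 (algebraMap A R c) : S →ₐ[A] _) =
      (unitHom A _).comp (𝒮.colin c) := fun c => by
    ext s
    have h := proj_rel (OdotRel.right_scalar (𝒮 := 𝒮) (R := R) s c)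
    rw [← MvPolynomial.algebraMap_eq, AlgHom.commutes] at h
    exact h
  { toFun := fun r => Witt.of (mkHom 𝒮 r)
    map_one' := by
      have h := hlin 1
      rw [map_one] at h
      exact h
    map_mul' := hmul
    map_zero' := by
      have h := hlin 0
      rw [map_zero] at h
      exact h
    map_add' := hadd
    commutes' := hlin }

theorem univ_hom_apply (r : R) (s : S) : (univ 𝒮 r).hom s = mk 𝒮 s r := rfl

/-- The algebra homomorphism `S ⊙ R → B`, `s ⊙ r ↦ g r s`, induced by an algebra homomorphism
`g : R → W_S(B)`. -/
def lift (g : R →ₐ[A] Witt 𝒮 B) : Odot 𝒮 R →ₐ[A] B :=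
  RingQuot.liftAlgHom A ⟨MvPolynomial.aeval fun p : S × R => (g p.2).hom p.1, by
    intro x y h
    induction h with
    | left_add s s' r => simp
    | left_mul s s' r => simp
    | left_scalar c r => simp
    | right_add s r r' l hl =>
      simp only [MvPolynomial.aeval_X, map_add, Witt.hom_add, conv, AlgHom.comp_apply, hl,
        map_list_sum, List.map_map]
      congr 1
      apply List.map_congr_left
      intro p _
      simp
    | right_mul s r r' l hl =>
      simp only [MvPolynomial.aeval_X, map_mul, Witt.hom_mul, conv, AlgHom.comp_apply, hl,
        map_list_sum, List.map_map]
      congr 1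
      apply List.map_congr_left
      intro p _
      simp
    | right_scalar s c =>
      simp only [MvPolynomial.aeval_X, AlgHom.commutes, Witt.hom_algebraMap]
      simp [Algebra.ofId_apply]⟩

theorem lift_mk (g : R →ₐ[A] Witt 𝒮 B) (s : S) (r : R) : lift 𝒮 g (mk 𝒮 s r) = (g r).hom s := by
  unfold lift mk proj
  erw [RingQuot.liftAlgHom_mkAlgHom_apply]
  simp

/-- The adjunction `Hom_A(S ⊙ R, B) ≃ Hom_A(R, W_S(B))`. -/
def homEquiv : (Odot 𝒮 R →ₐ[A] B) ≃ (R →ₐ[A] Witt 𝒮 B) where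
  toFun f := (Witt.map 𝒮 f).comp (univ 𝒮)
  invFun g := lift 𝒮 g
  left_inv f := hom_ext 𝒮 fun s r => lift_mk 𝒮 _ s r
  right_inv g := by
    apply AlgHom.ext
    intro r
    apply Witt.hom_injective
    ext s
    exact lift_mk 𝒮 g s r

theorem homEquiv_comp (f : B →ₐ[A] B') (g : Odot 𝒮 R →ₐ[A] B) :
    homEquiv 𝒮 (f.comp g) = (Witt.map 𝒮 f).comp (homEquiv 𝒮 g) := rfl

/-- Functoriality of `S ⊙ -`: `s ⊙ r ↦ s ⊙ f r`. -/
def map (f : R →ₐ[A] R') : Odot 𝒮 R →ₐ[A] Odot 𝒮 R' := lift 𝒮 ((univ 𝒮).comp f)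

theorem map_mk (f : R →ₐ[A] R') (s : S) (r : R) : map 𝒮 f (mk 𝒮 s r) = mk 𝒮 s (f r) :=
  lift_mk 𝒮 _ s r

end Odot

end Odot

/-! ### Birings: the unit `A[X]` and the composition product -/

/-- The standard biring structure on `A[X]`, which represents the identity functor. -/
def polyBiring (A : Type*) [CommRing A] : Biring A (Polynomial A) where
  coadd := Polynomial.aeval (Polynomial.X ⊗ₜ[A] 1 + 1 ⊗ₜ[A] Polynomial.X)
  comul := Polynomial.aeval (Polynomial.X ⊗ₜ[A] Polynomial.X)
  coneg := Polynomial.aeval (-Polynomial.X)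
  colin a := Polynomial.aeval a
  coadd_assoc := by
    ext
    simp [conv, in₁, in₂, in₃, ← Algebra.TensorProduct.one_def, add_assoc]
  coadd_comm := by ext; simp [add_comm]
  coadd_zero := by ext; simp [conv]
  coadd_neg := by ext; simp [conv]
  comul_assoc := by ext; simp [conv, in₁, in₂, in₃]
  comul_comm := by ext; simp
  comul_one := by ext; simp [conv]
  codistrib := by
    ext
    simp [conv, in₁, in₂, in₃, mul_add]
  colin_add a b := by ext; simp [conv]
  colin_mul a b := by ext; simp [conv]

section OdotBiring

variable {A S T : Type*} [CommRing A] [CommRing S] [Algebra A S] [CommRing T] [Algebra A T]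
  (𝒮 : Biring A S) (𝒯 : Biring A T)

/-- The bijection `Hom_A(S ⊙ T, B) ≃ W_T(W_S(B))`. -/
def odotPoints {B : Type*} [CommRing B] [Algebra A B] :
    (Odot 𝒮 T →ₐ[A] B) ≃ Witt 𝒯 (Witt 𝒮 B) := Odot.homEquiv 𝒮

theorem odotPoints_comp {B B' : Type*} [CommRing B] [Algebra A B] [CommRing B'] [Algebra A B']
    (f : B →ₐ[A] B') (g : Odot 𝒮 T →ₐ[A] B) :
    odotPoints 𝒮 𝒯 (f.comp g) = Witt.map 𝒯 (Witt.map 𝒮 f) (odotPoints 𝒮 𝒯 g) := rfl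

/-- Co-addition on `S ⊙ T`: the sum of the two coprojections in
`W_T(W_S((S ⊙ T) ⊗ (S ⊙ T)))`. -/
def odotCoadd : Odot 𝒮 T →ₐ[A] Odot 𝒮 T ⊗[A] Odot 𝒮 T :=
  (odotPoints 𝒮 𝒯).symm (odotPoints 𝒮 𝒯 Algebra.TensorProduct.includeLeft +
    odotPoints 𝒮 𝒯 Algebra.TensorProduct.includeRight)

/-- Co-multiplication on `S ⊙ T`: the product of the two coprojections. -/
def odotComul : Odot 𝒮 T →ₐ[A] Odot 𝒮 T ⊗[A] Odot 𝒮 T :=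
  (odotPoints 𝒮 𝒯).symm (odotPoints 𝒮 𝒯 Algebra.TensorProduct.includeLeft *
    odotPoints 𝒮 𝒯 Algebra.TensorProduct.includeRight)

/-- The co-additive inverse on `S ⊙ T`. -/
def odotConeg : Odot 𝒮 T →ₐ[A] Odot 𝒮 T :=
  (odotPoints 𝒮 𝒯).symm (-(odotPoints 𝒮 𝒯 (AlgHom.id A _)))

/-- The co-`A`-linear structure on `S ⊙ T`. -/
def odotColin (a : A) : Odot 𝒮 T →ₐ[A] A :=
  (odotPoints 𝒮 𝒯).symm (algebraMap A (Witt 𝒯 (Witt 𝒮 A)) a)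

variable {B : Type*} [CommRing B] [Algebra A B]

theorem odotPoints_coadd (φ ψ : Odot 𝒮 T →ₐ[A] B) :
    odotPoints 𝒮 𝒯 (conv (odotCoadd 𝒮 𝒯) φ ψ) = odotPoints 𝒮 𝒯 φ + odotPoints 𝒮 𝒯 ψ := by
  unfold conv
  rw [odotPoints_comp, odotCoadd, Equiv.apply_symm_apply, map_add, ← odotPoints_comp,
    ← odotPoints_comp, Algebra.TensorProduct.productMap_left,
    Algebra.TensorProduct.productMap_right]

theorem odotPoints_comul (φ ψ : Odot 𝒮 T →ₐ[A] B) :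
    odotPoints 𝒮 𝒯 (conv (odotComul 𝒮 𝒯) φ ψ) = odotPoints 𝒮 𝒯 φ * odotPoints 𝒮 𝒯 ψ := by
  unfold conv
  rw [odotPoints_comp, odotComul, Equiv.apply_symm_apply, map_mul, ← odotPoints_comp,
    ← odotPoints_comp, Algebra.TensorProduct.productMap_left,
    Algebra.TensorProduct.productMap_right]

theorem odotPoints_colin (a : A) :
    odotPoints 𝒮 𝒯 ((unitHom A B).comp (odotColin 𝒮 𝒯 a)) = algebraMap A _ a := by
  rw [odotPoints_comp, odotColin, Equiv.apply_symm_apply, AlgHom.commutes]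

theorem conv_incl {S : Type*} [CommRing S] [Algebra A S] (m : S →ₐ[A] S ⊗[A] S) :
    conv m Algebra.TensorProduct.includeLeft Algebra.TensorProduct.includeRight = m := by
  unfold conv
  conv_rhs => rw [← AlgHom.id_comp m]
  congr 1
  ext <;> simp

theorem conv_incl_swap {S : Type*} [CommRing S] [Algebra A S] (m : S →ₐ[A] S ⊗[A] S) :
    (Algebra.TensorProduct.comm A S S).toAlgHom.comp m =
    conv m Algebra.TensorProduct.includeRight Algebra.TensorProduct.includeLeft := by
  unfold conv
  congr 1
  ext <;> simp

/-- The biring structure on the composition product `S ⊙ T` of two birings. It is the one for which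
`Hom_A(S ⊙ T, B) ≃ W_T(W_S(B))` is an isomorphism of `A`-algebras for all `B`. -/
def odotBiring : Biring A (Odot 𝒮 T) where
  coadd := odotCoadd 𝒮 𝒯
  comul := odotComul 𝒮 𝒯
  coneg := odotConeg 𝒮 𝒯
  colin := odotColin 𝒮 𝒯
  coadd_assoc := by
    apply (odotPoints 𝒮 𝒯).injective
    simp only [odotPoints_coadd, add_assoc]
  coadd_comm := by
    rw [conv_incl_swap]
    conv_rhs => rw [← conv_incl (odotCoadd 𝒮 𝒯)]
    apply (odotPoints 𝒮 𝒯).injective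
    simp only [odotPoints_coadd, add_comm]
  coadd_zero := by
    apply (odotPoints 𝒮 𝒯).injective
    simp only [odotPoints_coadd, odotPoints_colin, map_zero, zero_add]
  coadd_neg := by
    apply (odotPoints 𝒮 𝒯).injective
    simp only [odotPoints_coadd, odotPoints_colin, map_zero, odotConeg, Equiv.apply_symm_apply,
      neg_add_cancel]
  comul_assoc := by
    apply (odotPoints 𝒮 𝒯).injective
    simp only [odotPoints_comul, mul_assoc]
  comul_comm := by
    rw [conv_incl_swap]
    conv_rhs => rw [← conv_incl (odotComul 𝒮 𝒯)]
    apply (odotPoints 𝒮 𝒯).injective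
    simp only [odotPoints_comul, mul_comm]
  comul_one := by
    apply (odotPoints 𝒮 𝒯).injective
    simp only [odotPoints_comul, odotPoints_colin, map_one, one_mul]
  codistrib := by
    apply (odotPoints 𝒮 𝒯).injective
    simp only [odotPoints_comul, odotPoints_coadd, mul_add]
  colin_add a b := by
    apply (odotPoints 𝒮 𝒯).injective
    simp only [odotPoints_coadd, odotColin, Equiv.apply_symm_apply, map_add]
  colin_mul a b := by
    apply (odotPoints 𝒮 𝒯).injective
    simp only [odotPoints_comul, odotColin, Equiv.apply_symm_apply, map_mul]

end OdotBiring

/-! ### Plethories and `P`-rings -/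

/-- An `A`-plethory structure on the `A`-algebra `P`: a monoid object in the monoidal category of
`A`-`A`-birings under `⊙`, with unit object `A[X]`. Associativity and the unit laws are stated on
the algebra generators `(a ⊙ b) ⊙ c` of `(P ⊙ P) ⊙ P`, `X ⊙ a` of `A[X] ⊙ P` and `a ⊙ X` of
`P ⊙ A[X]`. -/
structure Plethory (A P : Type*) [CommRing A] [CommRing P] [Algebra A P] extends
    Biring A P where
  comp : Odot toBiring P →ₐ[A] P
  comp_isBiringHom : IsBiringHom (odotBiring toBiring toBiring) toBiring comp
  comp_assoc : ∀ a b c : P,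
    comp (Odot.mk _ (comp (Odot.mk _ a b)) c) = comp (Odot.mk _ a (comp (Odot.mk _ b c)))
  unit : Polynomial A →ₐ[A] P
  unit_isBiringHom : IsBiringHom (polyBiring A) toBiring unit
  unit_comp : ∀ a : P, comp (Odot.mk _ (unit Polynomial.X) a) = a
  comp_unit : ∀ a : P, comp (Odot.mk _ a (unit Polynomial.X)) = a

/-- A `P`-ring structure on the `A`-algebra `R`: a left action of the plethory `P` on `R`. -/
@[ext]
structure PRing {A P : Type*} [CommRing A] [CommRing P] [Algebra A P] (Q : Plethory A P)
    (R : Type*) [CommRing R] [Algebra A R] where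
  act : Odot Q.toBiring R →ₐ[A] R
  act_act : ∀ (a b : P) (r : R),
    act (Odot.mk _ (Q.comp (Odot.mk _ a b)) r) = act (Odot.mk _ a (act (Odot.mk _ b r)))
  unit_act : ∀ r : R, act (Odot.mk _ (Q.unit Polynomial.X) r) = r

/-! ### The functors `W_S` and `S ⊙ -` -/

section Functors

variable {A S : Type u} [CommRing A] [CommRing S] [Algebra A S] (𝒮 : Biring A S)

/-- The functor `W_S = Hom_A(S, -)` from `A`-algebras to `A`-algebras. -/
def wittFunctor : CommAlgCat.{u} A ⥤ CommAlgCat.{u} A where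
  obj R := CommAlgCat.of A (Witt 𝒮 R)
  map f := CommAlgCat.ofHom (Witt.map 𝒮 f.hom)

/-- The functor `S ⊙ -` from `A`-algebras to `A`-algebras. -/
def odotFunctor : CommAlgCat.{u} A ⥤ CommAlgCat.{u} A where
  obj R := CommAlgCat.of A (Odot 𝒮 R)
  map f := CommAlgCat.ofHom (Odot.map 𝒮 f.hom)
  map_id R := by
    apply CommAlgCat.hom_ext
    exact Odot.hom_ext 𝒮 fun s r => Odot.map_mk 𝒮 _ s r
  map_comp f g := by
    apply CommAlgCat.hom_ext
    refine Odot.hom_ext 𝒮 fun s r => ?_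
    simp [Odot.map_mk]

end Functors

/-! ### Integer-valued polynomials -/

section Int

variable (D K : Type*) [CommRing D] [Field K] [Algebra D K]

/-- `Int(D)`: the polynomials `f ∈ K[X]` with `f(D) ⊆ D`. -/
def IntPoly : Subalgebra D (Polynomial K) where
  carrier := {f | ∀ d : D, f.eval (algebraMap D K d) ∈ (algebraMap D K).range}
  mul_mem' hf hg d := by
    rw [Polynomial.eval_mul]; exact mul_mem (hf d) (hg d)
  add_mem' hf hg d := by
    rw [Polynomial.eval_add]; exact add_mem (hf d) (hg d)
  algebraMap_mem' r d := ⟨r, by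
    rw [IsScalarTower.algebraMap_apply D K (Polynomial K)]; simp⟩

theorem X_mem_intPoly : (Polynomial.X : Polynomial K) ∈ IntPoly D K := fun d => by simp

/-- `X` as an element of `Int(D)`. -/
def intX : IntPoly D K := ⟨Polynomial.X, X_mem_intPoly D K⟩

/-- The inclusion `D[X] → Int(D)`. -/
def polyToInt : Polynomial D →ₐ[D] IntPoly D K := Polynomial.aeval (intX D K)

theorem coe_polyToInt (f : Polynomial D) :
    (polyToInt D K f : Polynomial K) = f.map (algebraMap D K) := by
  have h : (IntPoly D K).val.comp (polyToInt D K) = Polynomial.mapAlg D K := by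
    apply Polynomial.algHom_ext
    simp [polyToInt, intX, Polynomial.mapAlg_eq_map]
  rw [← Polynomial.mapAlg_eq_map, ← h]
  rfl

/-- A `D`-algebra `A` is weakly polynomially complete (WPC) if for every `a ∈ A` there is a
`D`-algebra homomorphism `Int(D) → A` sending `X` to `a`. -/
def IsWPC (A : Type*) [CommRing A] [Algebra D A] : Prop :=
  ∀ a : A, ∃ φ : IntPoly D K →ₐ[D] A, φ (intX D K) = a

/-- `w^D(A)`: the compositum of all WPC `D`-algebras contained in `A`. -/
def wUpper (A : Type*) [CommRing A] [Algebra D A] : Subalgebra D A :=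
  sSup {B | IsWPC D K B}

/-- `w_D(A)`: the intersection of all WPC `D`-algebras that contain (the image of) `A` and are
contained in `K ⊗ A`. -/
def wLower (A : Type*) [CommRing A] [Algebra D A] : Subalgebra D (K ⊗[D] A) :=
  sInf {B | (Algebra.TensorProduct.includeRight : A →ₐ[D] K ⊗[D] A).range ≤ B ∧ IsWPC D K B}

/-- `T(A)`: the image of `A` in `K ⊗ A`. -/
def torsionQuot (A : Type*) [CommRing A] [Algebra D A] : Subalgebra D (K ⊗[D] A) :=
  (Algebra.TensorProduct.includeRight : A →ₐ[D] K ⊗[D] A).range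

/-- The canonical map `A → T(A)`. -/
def toTorsionQuot (A : Type*) [CommRing A] [Algebra D A] : A →ₐ[D] torsionQuot D K A :=
  (Algebra.TensorProduct.includeRight : A →ₐ[D] K ⊗[D] A).rangeRestrict

/-- `Int_⊗(D^σ)`: the compositum in `K[X_i : i ∈ σ]` of the rings of integer-valued polynomials in
the single variables `X_i`, i.e. the image of the coproduct of `D`-algebras `⨂_{i ∈ σ} Int(D)`
under the canonical map to `Int(D^σ)`. -/
def intTensor (σ : Type*) : Subalgebra D (MvPolynomial σ K) :=
  Algebra.adjoin D {p | ∃ f ∈ IntPoly D K, ∃ i, p = Polynomial.aeval (MvPolynomial.X i) f}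

/-- `Int_w(D^σ)`: the smallest ring of polynomials over `K` that contains `D[X_i : i ∈ σ]` and that
contains `f(g)` for all its elements `g` and all `f ∈ Int(D)`. It is contained in `Int(D^σ)`, since
`Int(D^σ)` has these two properties. -/
def intWeak (σ : Type*) : Subalgebra D (MvPolynomial σ K) :=
  sInf {B | (∀ i, MvPolynomial.X i ∈ B) ∧ ∀ f ∈ IntPoly D K, ∀ g ∈ B, Polynomial.aeval g f ∈ B}

variable {D K} {A B : Type*} [CommRing A] [Algebra D A] [CommRing B] [Algebra D B]

theorem IsWPC.map (f : A →ₐ[D] B) (C : Subalgebra D A) (h : IsWPC D K C) :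
    IsWPC D K (C.map f) := by
  rintro ⟨_, c, hc, rfl⟩
  obtain ⟨φ, hφ⟩ := h ⟨c, hc⟩
  let g : C →ₐ[D] C.map f := (f.comp C.val).codRestrict _ fun x => ⟨x, x.2, rfl⟩
  refine ⟨g.comp φ, ?_⟩
  rw [AlgHom.comp_apply, hφ]
  rfl

theorem wUpper_map_le (f : A →ₐ[D] B) : wUpper D K A ≤ (wUpper D K B).comap f := by
  refine sSup_le fun C hC => ?_
  rw [← Subalgebra.map_le]
  exact le_sSup (IsWPC.map f C hC)

theorem torsionQuot_map_le (f : A →ₐ[D] B) :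
    torsionQuot D K A ≤
      (torsionQuot D K B).comap (Algebra.TensorProduct.map (AlgHom.id D K) f) := by
  rintro _ ⟨a, rfl⟩
  exact ⟨f a, by simp⟩

/-- Restriction of an algebra homomorphism to subalgebras. -/
def restr (f : A →ₐ[D] B) (C : Subalgebra D A) (E : Subalgebra D B) (h : C ≤ E.comap f) :
    C →ₐ[D] E :=
  (f.comp C.val).codRestrict E fun x => h x.2

theorem coe_restr (f : A →ₐ[D] B) (C : Subalgebra D A) (E : Subalgebra D B) (h : C ≤ E.comap f)
    (x : C) : (restr f C E h x : B) = f x := rfl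

section Field

variable [IsDomain D] [IsFractionRing D K]

/-- In a `K`-algebra, a homomorphism from `Int(D)` is evaluation at the image of `X`. -/
theorem intPoly_hom_eq_aeval {L : Type*} [CommRing L] [Algebra D L] [Algebra K L]
    [IsScalarTower D K L] (φ : IntPoly D K →ₐ[D] L) (f : IntPoly D K) :
    φ f = Polynomial.aeval (φ (intX D K)) (f : Polynomial K) := by
  obtain ⟨b, hb, hbf⟩ :=
    IsLocalization.integerNormalization_spec (nonZeroDivisors D) (f : Polynomial K)
  set g := IsLocalization.integerNormalization (nonZeroDivisors D) (f : Polynomial K)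
  have hbf' : polyToInt D K g = b • f := Subtype.ext (by rw [coe_polyToInt, hbf]; rfl)
  have h1 : φ (polyToInt D K g) = Polynomial.aeval (φ (intX D K)) g := by
    have h : φ.comp (polyToInt D K) = Polynomial.aeval (φ (intX D K)) := by
      apply Polynomial.algHom_ext
      simp [polyToInt]
    rw [← h]
    rfl
  have h2 : b • φ f = b • Polynomial.aeval (φ (intX D K)) (f : Polynomial K) := by
    rw [← map_smul, ← hbf', h1, ← Polynomial.aeval_map_algebraMap K, hbf,
      ← algebraMap_smul K b (f : Polynomial K), map_smul, algebraMap_smul]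
  have hb0 : algebraMap D K b ≠ 0 := by
    simpa using nonZeroDivisors.ne_zero hb
  rw [← algebraMap_smul K b (φ f), ← algebraMap_smul K b (Polynomial.aeval _ _)] at h2
  exact (IsUnit.mk0 _ hb0).smul_left_cancel.1 h2

theorem isWPC_subalgebra_iff {L : Type*} [CommRing L] [Algebra D L] [Algebra K L]
    [IsScalarTower D K L] (C : Subalgebra D L) :
    IsWPC D K C ↔ ∀ f ∈ IntPoly D K, ∀ x ∈ C, Polynomial.aeval x f ∈ C := by
  constructor
  · intro h f hf x hx
    obtain ⟨φ, hφ⟩ := h ⟨x, hx⟩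
    have h1 := intPoly_hom_eq_aeval (C.val.comp φ) ⟨f, hf⟩
    simp only [AlgHom.comp_apply, hφ] at h1
    rw [show x = C.val ⟨x, hx⟩ from rfl, ← h1]
    exact (φ ⟨f, hf⟩).2
  · rintro h ⟨x, hx⟩
    let g : IntPoly D K →ₐ[D] C :=
      (((Polynomial.aeval x : Polynomial K →ₐ[K] L).restrictScalars D).comp
        (IntPoly D K).val).codRestrict C fun f => h f f.2 x hx
    refine ⟨g, Subtype.ext ?_⟩
    change Polynomial.aeval x (Polynomial.X : Polynomial K) = x
    simp

theorem wLower_map_le (f : A →ₐ[D] B) :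
    wLower D K A ≤ (wLower D K B).comap (Algebra.TensorProduct.map (AlgHom.id D K) f) := by
  intro x hx
  rw [Subalgebra.mem_comap]
  refine Algebra.mem_sInf.2 ?_
  rintro C ⟨hC, hw⟩
  refine Algebra.mem_sInf.1 hx (C.comap (Algebra.TensorProduct.map (AlgHom.id D K) f)) ⟨?_, ?_⟩
  · rintro _ ⟨a, rfl⟩
    exact hC ⟨f a, by simp⟩
  · rw [isWPC_subalgebra_iff] at hw ⊢
    intro g hg y hy
    have h1 : Algebra.TensorProduct.map (AlgHom.id D K) f (Polynomial.aeval y g) =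
        Polynomial.aeval (Algebra.TensorProduct.map (AlgHom.id D K) f y) g :=
      (Polynomial.aeval_algHom_apply (Algebra.TensorProduct.map (AlgHom.id K K) f) y g).symm
    rw [Subalgebra.mem_comap, h1]
    exact hw g hg _ hy

end Field

end Int

/-! ### Functors and full subcategories -/

section IntFunctors

variable (D K : Type u) [CommRing D] [Field K] [Algebra D K]

/-- The property of being `D`-torsion-free. -/
def torsionFree : ObjectProperty (CommAlgCat.{u} D) := fun A => Module.IsTorsionFree D A

/-- The property of being `D`-torsion-free and WPC. -/
def torsionFreeWPC : ObjectProperty (CommAlgCat.{u} D) :=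
  fun A => Module.IsTorsionFree D A ∧ IsWPC D K A

/-- `D` is weakly polynomially composite: `Int_⊗(D^σ) = Int_w(D^σ)` for every set `σ`. -/
def IsWeaklyPolynomiallyComposite : Prop :=
  ∀ σ : Type u, intTensor D K σ = intWeak D K σ

/-- The endofunctor `F` of `D`-algebras takes values in the torsion-free WPC `D`-algebras, and is as
such a right adjoint of the inclusion of these into all `D`-algebras. -/
def IsRightAdjointOfInclusion (F : CommAlgCat.{u} D ⥤ CommAlgCat.{u} D) : Prop :=
  ∃ h : ∀ R, torsionFreeWPC D K (F.obj R),
    Nonempty ((torsionFreeWPC D K).ι ⊣ (torsionFreeWPC D K).lift F h)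

/-- The endofunctor `F` of `D`-algebras takes values in the torsion-free WPC `D`-algebras, and is as
such a left adjoint of the inclusion of these into all `D`-algebras. -/
def IsLeftAdjointOfInclusion (F : CommAlgCat.{u} D ⥤ CommAlgCat.{u} D) : Prop :=
  ∃ h : ∀ R, torsionFreeWPC D K (F.obj R),
    Nonempty ((torsionFreeWPC D K).lift F h ⊣ (torsionFreeWPC D K).ι)

/-- The functor `w^D`: homomorphisms act by restriction. -/
def wUpperFunctor : CommAlgCat.{u} D ⥤ CommAlgCat.{u} D where
  obj A := CommAlgCat.of D (wUpper D K A)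
  map f := CommAlgCat.ofHom (restr f.hom _ _ (wUpper_map_le f.hom))

/-- The functor `T`. -/
def torsionQuotFunctor : CommAlgCat.{u} D ⥤ CommAlgCat.{u} D where
  obj A := CommAlgCat.of D (torsionQuot D K A)
  map f := CommAlgCat.ofHom (restr (Algebra.TensorProduct.map (AlgHom.id D K) f.hom) _ _
    (torsionQuot_map_le f.hom))
  map_id A := by
    ext x
    simp [coe_restr]
  map_comp f g := by
    ext x
    simp only [CommAlgCat.hom_ofHom, CommAlgCat.hom_comp, AlgHom.comp_apply, coe_restr]
    rw [← AlgHom.comp_apply, ← Algebra.TensorProduct.map_comp, AlgHom.comp_id]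

variable [IsDomain D] [IsFractionRing D K]

/-- The functor `w_D`: a homomorphism `f` acts by restriction of `id ⊗ f`. -/
def wLowerFunctor : CommAlgCat.{u} D ⥤ CommAlgCat.{u} D where
  obj A := CommAlgCat.of D (wLower D K A)
  map f := CommAlgCat.ofHom (restr (Algebra.TensorProduct.map (AlgHom.id D K) f.hom) _ _
    (wLower_map_le f.hom))
  map_id A := by
    ext x
    simp [coe_restr]
  map_comp f g := by
    ext x
    simp only [CommAlgCat.hom_ofHom, CommAlgCat.hom_comp, AlgHom.comp_apply, coe_restr]
    rw [← AlgHom.comp_apply, ← Algebra.TensorProduct.map_comp, AlgHom.comp_id]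

end IntFunctors

end Pleth

end

/-!
Write `P = Int(D)`. The principle behind everything is that a homomorphism from `P` to a
torsion-free `D`-algebra is determined by its value at `X`, because every element of `P` has a
nonzero multiple in `D[X]` (`intPoly_hom_ext`). A WPC algebra is one in which every value at `X`
occurs; so evaluation at `X` identifies `W(B)` with `B` for torsion-free WPC `B` (`evalEquiv`).

*Existence.* If `P ⊗ P` is torsion-free, it embeds in `K[X, Y]` with image `Int_⊗(D²)`. The ring
`Int_w(D²)` is WPC by its definition, so if the two agree then `P ⊗ P` is WPC
(`isWPC_intPoly_tensor`), and there are homomorphisms `P → P ⊗ P` with `X ↦ X ⊗ 1 + 1 ⊗ X` and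
`X ↦ X ⊗ X`. The laws of a biring and of a plethory are equalities of homomorphisms to
torsion-free algebras, and hold since they do at `X` (`intBiring`, `intPlethory`);
torsion-freeness of the second and third tensor powers is enough.

*Actions.* For any plethory, `W(R)` and `P ⊙ R` are `P`-rings through the composition of the
plethory (`PRing.witt`, `PRing.odot`), and a `P`-ring is WPC through `f ↦ f ∘ a`. On a
torsion-free WPC algebra the only action is evaluation (`PRing.ofIsWPC`).

*The functors on torsion-free algebras.* The map `W(A) → A` is injective with WPC image, and this
image contains every WPC subalgebra. Evaluation `P ⊙ A → K ⊗ A` becomes an isomorphism after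
tensoring with `K`, with inverse induced by `a ↦ X ⊙ a` (`odotEvalExt_injective`), so that
`T(P ⊙ A)` is its image `w_D(A)`.

*Adjunctions.* `Hom(P ⊙ R, B) = Hom(R, W(B)) = Hom(R, B)` for torsion-free WPC `B`
(`comp_odotUnit_bijective`), and the homomorphisms to `B` factor through `T`. If `W(R)` is
torsion-free, every homomorphism `B → W(R)` respects the `P`-actions, which makes it recoverable
from its composite with `W(R) → R` (`eval_comp_bijective`).

*Principal ideal domains.* If `p` is a prime with residue field of `q` elements and `p a = 0` in a
`P`-ring, applying `(X ^ q - X) / p` to `p a` gives both `0` and `- a`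
(`PRing.eq_zero_of_prime_smul_eq_zero`).
-/

namespace Pleth

/-! ### Points of birings and plethories -/

section Generic

variable {A S : Type*} [CommRing A] [CommRing S] [Algebra A S]

theorem conv_comp_of_coop {T R : Type*} [CommRing T] [Algebra A T] [CommRing R] [Algebra A R]
    {m : S →ₐ[A] S ⊗[A] S} {m' : T →ₐ[A] T ⊗[A] T} {f : S →ₐ[A] T}
    (h : (Algebra.TensorProduct.map f f).comp m = m'.comp f) (φ ψ : T →ₐ[A] R) :
    (conv m' φ ψ).comp f = conv m (φ.comp f) (ψ.comp f) := by
  unfold conv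
  rw [AlgHom.comp_assoc, ← h, ← AlgHom.comp_assoc]
  congr 1
  ext <;> simp

theorem conv_apply_of_primitive {R : Type*} [CommRing R] [Algebra A R] {m : S →ₐ[A] S ⊗[A] S}
    {x : S} (h : m x = x ⊗ₜ 1 + 1 ⊗ₜ x) (φ ψ : S →ₐ[A] R) : conv m φ ψ x = φ x + ψ x := by
  simp [conv, h]

theorem conv_apply_of_groupLike {R : Type*} [CommRing R] [Algebra A R] {m : S →ₐ[A] S ⊗[A] S}
    {x : S} (h : m x = x ⊗ₜ x) (φ ψ : S →ₐ[A] R) : conv m φ ψ x = φ x * ψ x := by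
  simp [conv, h]

namespace IsBiringHom

variable {𝒮 : Biring A S} {i : Polynomial A →ₐ[A] S} (hi : IsBiringHom (polyBiring A) 𝒮 i)
include hi

theorem coadd_X : 𝒮.coadd (i Polynomial.X) =
    i Polynomial.X ⊗ₜ 1 + 1 ⊗ₜ i Polynomial.X := by
  have h := DFunLike.congr_fun hi.map_coadd Polynomial.X
  simpa [polyBiring] using h.symm

theorem comul_X : 𝒮.comul (i Polynomial.X) = i Polynomial.X ⊗ₜ i Polynomial.X := by
  have h := DFunLike.congr_fun hi.map_comul Polynomial.X
  simpa [polyBiring] using h.symm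

theorem colin_X (a : A) : 𝒮.colin a (i Polynomial.X) = a := by
  have h := DFunLike.congr_fun (hi.map_colin a) Polynomial.X
  simpa [polyBiring] using h

end IsBiringHom

/-- For a biring `S` under `A[X]`, evaluation at the image of `X` is a homomorphism
`W_S(R) → R` of `A`-algebras: it is `W_S(R) → W_{A[X]}(R) = R`. -/
noncomputable def Witt.eval {𝒮 : Biring A S} {i : Polynomial A →ₐ[A] S}
    (hi : IsBiringHom (polyBiring A) 𝒮 i) (R : Type*) [CommRing R] [Algebra A R] :
    Witt 𝒮 R →ₐ[A] R where
  toFun φ := φ.hom (i Polynomial.X)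
  map_one' := by simp [Witt.hom_one, hi.colin_X]
  map_mul' φ ψ := by rw [Witt.hom_mul, conv_apply_of_groupLike hi.comul_X]
  map_zero' := by simp [Witt.hom_zero, hi.colin_X]
  map_add' φ ψ := by rw [Witt.hom_add, conv_apply_of_primitive hi.coadd_X]
  commutes' a := by simp [Witt.hom_algebraMap, hi.colin_X, Algebra.ofId_apply]

theorem Witt.eval_apply {𝒮 : Biring A S} {i : Polynomial A →ₐ[A] S}
    (hi : IsBiringHom (polyBiring A) 𝒮 i) {R : Type*} [CommRing R] [Algebra A R] (φ : Witt 𝒮 R) :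
    Witt.eval hi R φ = φ.hom (i Polynomial.X) := rfl

theorem Odot.adjoin_mk (𝒮 : Biring A S) (R : Type*) [CommRing R] [Algebra A R] :
    Algebra.adjoin A {x | ∃ s r, x = Odot.mk 𝒮 s r} = (⊤ : Subalgebra A (Odot 𝒮 R)) := by
  have hs : Function.Surjective (Odot.proj 𝒮 (R := R)) := RingQuot.mkAlgHom_surjective A _
  refine top_le_iff.1 ?_
  rw [← (AlgHom.range_eq_top _).2 hs, ← Algebra.map_top, ← MvPolynomial.adjoin_range_X,
    AlgHom.map_adjoin]
  refine Algebra.adjoin_mono ?_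
  rintro _ ⟨_, ⟨⟨s, r⟩, rfl⟩, rfl⟩
  exact ⟨s, r, rfl⟩

end Generic

section GenericPlethory

variable {A P : Type*} [CommRing A] [CommRing P] [Algebra A P] (Q : Plethory A P)
  {R : Type*} [CommRing R] [Algebra A R]

/-- The comultiplication `W(R) → W(W(R))` dual to composition: `φ ↦ (b ↦ (a ↦ φ (a ∘ b)))`. -/
noncomputable def Plethory.comult (R : Type*) [CommRing R] [Algebra A R] :
    Witt Q.toBiring R →ₐ[A] Witt Q.toBiring (Witt Q.toBiring R) :=
  have hcolin : ∀ a, odotPoints Q.toBiring Q.toBiring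
      (((unitHom A R).comp (Q.colin a)).comp Q.comp) = algebraMap A _ a := fun a => by
    rw [AlgHom.comp_assoc, Q.comp_isBiringHom.map_colin a]
    exact odotPoints_colin _ _ a
  { toFun := fun φ => odotPoints _ _ (φ.hom.comp Q.comp)
    map_one' := (hcolin 1).trans (map_one _)
    map_mul' := fun φ ψ => by
      rw [Witt.hom_mul, conv_comp_of_coop Q.comp_isBiringHom.map_comul]
      exact odotPoints_comul _ _ _ _
    map_zero' := (hcolin 0).trans (map_zero _)
    map_add' := fun φ ψ => by
      rw [Witt.hom_add, conv_comp_of_coop Q.comp_isBiringHom.map_coadd]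
      exact odotPoints_coadd _ _ _ _
    commutes' := hcolin }

theorem Plethory.hom_hom_comult (φ : Witt Q.toBiring R) (a b : P) :
    ((Q.comult R φ).hom b).hom a = φ.hom (Q.comp (Odot.mk _ a b)) := rfl

/-- A `P`-ring structure from the coaction `R → W(R)`, `r ↦ (a ↦ a ∘ r)`. -/
noncomputable def PRing.ofCoaction (c : R →ₐ[A] Witt Q.toBiring R)
    (hcomp : ∀ r a b, (c r).hom (Q.comp (Odot.mk _ a b)) = (c ((c r).hom b)).hom a)
    (hunit : ∀ r, (c r).hom (Q.unit Polynomial.X) = r) : PRing Q R where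
  act := Odot.lift _ c
  act_act a b r := by simp only [Odot.lift_mk, hcomp]
  unit_act r := by rw [Odot.lift_mk, hunit]

/-- `W(R)` is a `P`-ring under `b ∘ φ = (a ↦ φ (a ∘ b))`. -/
noncomputable def PRing.witt (R : Type*) [CommRing R] [Algebra A R] :
    PRing Q (Witt Q.toBiring R) :=
  PRing.ofCoaction Q (Q.comult R)
    (fun φ a b => by
      apply Witt.hom_injective
      ext f
      simp only [Plethory.hom_hom_comult, Q.comp_assoc])
    (fun φ => by
      apply Witt.hom_injective
      ext f
      simp only [Plethory.hom_hom_comult, Q.comp_unit])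

theorem PRing.witt_act_mk (φ : Witt Q.toBiring R) (a b : P) :
    ((PRing.witt Q R).act (Odot.mk _ b φ)).hom a = φ.hom (Q.comp (Odot.mk _ a b)) := by
  simp only [PRing.witt, PRing.ofCoaction, Odot.lift_mk, Plethory.hom_hom_comult]

/-- The coaction `P ⊙ R → W(P ⊙ R)`, `b ⊙ r ↦ (a ↦ (a ∘ b) ⊙ r)`. -/
noncomputable def Plethory.odotCoaction (R : Type*) [CommRing R] [Algebra A R] :
    Odot Q.toBiring R →ₐ[A] Witt Q.toBiring (Odot Q.toBiring R) :=
  Odot.lift _ ((Q.comult _).comp (Odot.univ _))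

theorem Plethory.odotCoaction_mk (r : R) (a b : P) :
    (Q.odotCoaction R (Odot.mk _ b r)).hom a = Odot.mk _ (Q.comp (Odot.mk _ a b)) r := by
  rw [odotCoaction, Odot.lift_mk]
  rfl

/-- `P ⊙ R` is a `P`-ring under `a ∘ (b ⊙ r) = (a ∘ b) ⊙ r`. -/
noncomputable def PRing.odot (R : Type*) [CommRing R] [Algebra A R] :
    PRing Q (Odot Q.toBiring R) :=
  PRing.ofCoaction Q (Q.odotCoaction R)
    (fun x a b => by
      have h : (Q.comult _).comp (Q.odotCoaction R) =
          (Witt.map _ (Q.odotCoaction R)).comp (Q.odotCoaction R) := by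
        refine Odot.hom_ext _ fun s r => Witt.hom_injective ?_
        ext b
        apply Witt.hom_injective
        ext a
        simp only [AlgHom.comp_apply, Witt.hom_map, Plethory.hom_hom_comult,
          Plethory.odotCoaction_mk, Q.comp_assoc]
      exact congrArg (fun y : Witt Q.toBiring (Witt Q.toBiring _) => (y.hom b).hom a)
        (DFunLike.congr_fun h x))
    (fun x => by
      have h : (Witt.eval Q.unit_isBiringHom _).comp (Q.odotCoaction R) = AlgHom.id A _ := by
        refine Odot.hom_ext _ fun s r => ?_
        simp only [AlgHom.comp_apply, Witt.eval_apply, Plethory.odotCoaction_mk, Q.unit_comp,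
          AlgHom.id_apply]
      exact DFunLike.congr_fun h x)

end GenericPlethory

/-! ### Homomorphisms from the ring of integer-valued polynomials -/

section General

variable {D K : Type*} [CommRing D] [Field K] [Algebra D K]

theorem polyToInt_X : polyToInt D K Polynomial.X = intX D K := by simp [polyToInt]

/-- A `K`-algebra is WPC: polynomials over `K` can be evaluated in it. -/
theorem isWPC_of_fractionField_algebra (L : Type*) [CommRing L] [Algebra D L] [Algebra K L]
    [IsScalarTower D K L] : IsWPC D K L := fun x =>
  ⟨((Polynomial.aeval x : Polynomial K →ₐ[K] L).restrictScalars D).comp (IntPoly D K).val,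
    Polynomial.aeval_X x⟩

theorem IsWPC.range {A B : Type*} [CommRing A] [Algebra D A] [CommRing B] [Algebra D B]
    (h : IsWPC D K A) (f : A →ₐ[D] B) : IsWPC D K f.range := by
  rintro ⟨_, a, rfl⟩
  obtain ⟨φ, rfl⟩ := h a
  exact ⟨f.rangeRestrict.comp φ, rfl⟩

theorem toTorsionQuot_surjective (A : Type*) [CommRing A] [Algebra D A] :
    Function.Surjective (toTorsionQuot D K A) :=
  AlgHom.rangeRestrict_surjective _

section Biring

variable {𝒮 : Biring D (IntPoly D K)} (hi : IsBiringHom (polyBiring D) 𝒮 (polyToInt D K))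
  {A B : Type*} [CommRing A] [Algebra D A] [CommRing B] [Algebra D B]

theorem eval_apply_intX (φ : Witt 𝒮 B) : Witt.eval hi B φ = φ.hom (intX D K) := by
  rw [Witt.eval_apply, polyToInt_X]

theorem eval_surjective_iff : Function.Surjective (Witt.eval hi B) ↔ IsWPC D K B := by
  refine forall_congr' fun b => exists_congr fun φ => ?_
  rw [eval_apply_intX]
  rfl

/-- The canonical map `A → Int(D) ⊙ A`, `a ↦ X ⊙ a`. -/
noncomputable def odotUnit (A : Type*) [CommRing A] [Algebra D A] : A →ₐ[D] Odot 𝒮 A :=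
  (Witt.eval hi _).comp (Odot.univ 𝒮)

theorem odotUnit_apply (a : A) : odotUnit hi A a = Odot.mk 𝒮 (intX D K) a :=
  eval_apply_intX hi (Odot.univ 𝒮 a)

end Biring

end General

section TorsionFree

variable {D K : Type*} [CommRing D] [IsDomain D] [Field K] [Algebra D K] [IsFractionRing D K]

/-- Every integer-valued polynomial has a nonzero multiple with coefficients in `D`. -/
theorem exists_smul_mem_range_polyToInt (f : IntPoly D K) :
    ∃ b : D, b ≠ 0 ∧ ∃ g, polyToInt D K g = b • f := by
  obtain ⟨b, hb, hbf⟩ :=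
    IsLocalization.integerNormalization_spec (nonZeroDivisors D) (f : Polynomial K)
  refine ⟨b, nonZeroDivisors.ne_zero hb,
    IsLocalization.integerNormalization (nonZeroDivisors D) (f : Polynomial K),
    Subtype.ext ?_⟩
  rw [coe_polyToInt, hbf]
  rfl

/-- A homomorphism from `Int(D)` to a torsion-free algebra is determined by the image of `X`. -/
theorem intPoly_hom_ext {B : Type*} [CommRing B] [Algebra D B] [Module.IsTorsionFree D B]
    {φ ψ : IntPoly D K →ₐ[D] B} (h : φ (intX D K) = ψ (intX D K)) : φ = ψ := by
  have h' : φ.comp (polyToInt D K) = ψ.comp (polyToInt D K) := by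
    apply Polynomial.algHom_ext
    simp only [AlgHom.comp_apply, polyToInt_X, h]
  ext f
  obtain ⟨b, hb, g, hg⟩ := exists_smul_mem_range_polyToInt f
  apply smul_right_injective B hb
  change b • φ f = b • ψ f
  rw [← map_smul, ← map_smul, ← hg]
  exact DFunLike.congr_fun h' g

variable (D K) in
theorem isTorsionFree_of_fractionField_algebra (L : Type*) [CommRing L] [Algebra D L] [Algebra K L]
    [IsScalarTower D K L] : Module.IsTorsionFree D L :=
  .trans_faithfulSMul D K L

instance (A : Type*) [CommRing A] [Algebra D A] : Module.IsTorsionFree D (K ⊗[D] A) :=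
  isTorsionFree_of_fractionField_algebra D K _

instance : Module.IsTorsionFree D (IntPoly D K) :=
  have := isTorsionFree_of_fractionField_algebra D K (Polynomial K)
  inferInstance

variable (K) in
theorem includeRight_injective_of_isTorsionFree (A : Type*) [CommRing A] [Algebra D A]
    [Module.IsTorsionFree D A] :
    Function.Injective (Algebra.TensorProduct.includeRight : A →ₐ[D] K ⊗[D] A) := by
  intro x y h
  obtain ⟨c, hc⟩ := (IsLocalizedModule.eq_iff_exists (nonZeroDivisors D)
    (TensorProduct.mk D K A 1)).1 h
  exact smul_right_injective A (nonZeroDivisors.ne_zero c.2) hc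

section Biring

variable {𝒮 : Biring D (IntPoly D K)} (hi : IsBiringHom (polyBiring D) 𝒮 (polyToInt D K))
  {A B : Type*} [CommRing A] [Algebra D A] [CommRing B] [Algebra D B]

theorem eval_injective [Module.IsTorsionFree D B] : Function.Injective (Witt.eval hi B) := by
  intro φ ψ h
  rw [eval_apply_intX, eval_apply_intX] at h
  exact Witt.hom_injective (intPoly_hom_ext h)

/-- For a torsion-free WPC algebra `B`, evaluation at `X` identifies `W(B)` with `B`. -/
noncomputable def evalEquiv [Module.IsTorsionFree D B] (hB : IsWPC D K B) : Witt 𝒮 B ≃ₐ[D] B :=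
  AlgEquiv.ofBijective (Witt.eval hi B) ⟨eval_injective hi, (eval_surjective_iff hi).2 hB⟩

theorem evalEquiv_symm_intX [Module.IsTorsionFree D B] (hB : IsWPC D K B) (b : B) :
    ((evalEquiv hi hB).symm b).hom (intX D K) = b := by
  rw [← eval_apply_intX hi]
  exact (evalEquiv hi hB).apply_symm_apply b

/-- The evaluation map `Int(D) ⊙ A → K ⊗ A`, `f ⊙ a ↦ f (a)`. -/
noncomputable def odotEval (A : Type*) [CommRing A] [Algebra D A] : Odot 𝒮 A →ₐ[D] K ⊗[D] A :=
  Odot.lift 𝒮 (((evalEquiv hi (isWPC_of_fractionField_algebra (K ⊗[D] A))).symm.toAlgHom).comp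
    Algebra.TensorProduct.includeRight)

theorem odotEval_mk (f : IntPoly D K) (a : A) :
    odotEval hi A (Odot.mk 𝒮 f a) = Polynomial.aeval ((1 : K) ⊗ₜ[D] a) (f : Polynomial K) := by
  rw [odotEval, Odot.lift_mk, intPoly_hom_eq_aeval]
  exact congrArg (fun x => Polynomial.aeval x (f : Polynomial K))
    (evalEquiv_symm_intX hi (isWPC_of_fractionField_algebra _) _)

theorem odotEval_comp_map (g : A →ₐ[D] B) : (odotEval hi B).comp (Odot.map 𝒮 g) =
    (Algebra.TensorProduct.map (AlgHom.id D K) g).comp (odotEval hi A) := by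
  refine Odot.hom_ext 𝒮 fun f a => ?_
  rw [AlgHom.comp_apply, Odot.map_mk, odotEval_mk, AlgHom.comp_apply, odotEval_mk]
  refine Eq.trans ?_ (Polynomial.aeval_algHom_apply
    (Algebra.TensorProduct.map (AlgHom.id K K) g) ((1 : K) ⊗ₜ[D] a) (f : Polynomial K))
  rw [Algebra.TensorProduct.map_tmul, map_one]

/-- The `K`-linear extension `K ⊗ (Int(D) ⊙ A) → K ⊗ A` of evaluation. -/
noncomputable def odotEvalExt (A : Type*) [CommRing A] [Algebra D A] :
    K ⊗[D] Odot 𝒮 A →ₐ[K] K ⊗[D] A :=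
  Algebra.TensorProduct.lift (Algebra.ofId K (K ⊗[D] A)) (odotEval hi A)
    fun _ _ => Commute.all _ _

theorem odotEvalExt_one_tmul (x : Odot 𝒮 A) :
    odotEvalExt hi A ((1 : K) ⊗ₜ[D] x) = odotEval hi A x := by
  rw [odotEvalExt, Algebra.TensorProduct.lift_tmul, map_one, one_mul]

/-- Evaluation becomes an isomorphism over `K`: its inverse is induced by `a ↦ X ⊙ a`. In
particular the kernel of evaluation consists of the torsion elements. -/
theorem odotEvalExt_injective (A : Type*) [CommRing A] [Algebra D A] :
    Function.Injective (odotEvalExt hi A) := by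
  refine Function.LeftInverse.injective
    (g := Algebra.TensorProduct.map (AlgHom.id K K) (odotUnit hi A)) ?_
  refine DFunLike.congr_fun (f := (Algebra.TensorProduct.map _ _).comp
    (odotEvalExt hi A)) (g := AlgHom.id K _) ?_
  refine Algebra.TensorProduct.ext (by ext) ?_
  refine Odot.hom_ext 𝒮 fun f a => ?_
  have h := intPoly_hom_eq_aeval ((Algebra.TensorProduct.includeRight :
    Odot 𝒮 A →ₐ[D] K ⊗[D] Odot 𝒮 A).comp (Odot.mkHom 𝒮 a)) f
  simp only [AlgHom.comp_apply, Odot.mkHom_apply, Algebra.TensorProduct.includeRight_apply] at h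
  simp only [AlgHom.comp_apply, AlgHom.restrictScalars_apply,
    Algebra.TensorProduct.includeRight_apply, odotEvalExt_one_tmul, AlgHom.id_apply, odotEval_mk, h,
    ← Polynomial.aeval_algHom_apply,
    Algebra.TensorProduct.map_tmul, odotUnit_apply]
  rw [show ((intX D K : IntPoly D K) : Polynomial K) = Polynomial.X from rfl, Polynomial.aeval_X]

theorem range_includeRight_le_range_odotEval (A : Type*) [CommRing A] [Algebra D A] :
    (Algebra.TensorProduct.includeRight : A →ₐ[D] K ⊗[D] A).range ≤ (odotEval hi A).range := by
  rintro _ ⟨a, rfl⟩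
  refine ⟨Odot.mk 𝒮 (intX D K) a, ?_⟩
  change odotEval hi A _ = _
  rw [odotEval_mk]
  exact Polynomial.aeval_X _

/-- `w_D(A)` is the least WPC subalgebra of `K ⊗ A` containing `A`: being WPC means being closed
under evaluation of integer-valued polynomials, which passes to intersections. -/
theorem isLeast_wLower (A : Type*) [CommRing A] [Algebra D A] :
    IsLeast {B : Subalgebra D (K ⊗[D] A) |
      (Algebra.TensorProduct.includeRight : A →ₐ[D] K ⊗[D] A).range ≤ B ∧ IsWPC D K B}
      (wLower D K A) := by
  refine ⟨⟨le_sInf fun _ h => h.1, ?_⟩, fun B hB => sInf_le hB⟩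
  rw [isWPC_subalgebra_iff]
  intro f hf x hx
  refine Algebra.mem_sInf.2 fun B hB => ?_
  exact (isWPC_subalgebra_iff B).1 hB.2 f hf x (Algebra.mem_sInf.1 hx B hB)

theorem range_odotEval (hO : IsWPC D K (Odot 𝒮 A)) : (odotEval hi A).range = wLower D K A := by
  refine le_antisymm ?_ ((isLeast_wLower A).2 ⟨range_includeRight_le_range_odotEval hi A,
    hO.range _⟩)
  rw [← Algebra.map_top, ← Odot.adjoin_mk, AlgHom.map_adjoin, Algebra.adjoin_le_iff]
  rintro _ ⟨_, ⟨f, a, rfl⟩, rfl⟩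
  change odotEval hi A _ ∈ wLower D K A
  rw [odotEval_mk]
  exact (isWPC_subalgebra_iff (wLower D K A)).1 (isLeast_wLower A).1.2 f f.2 _
    ((isLeast_wLower A).1.1 ⟨a, rfl⟩)

/-- `T(Int(D) ⊙ A) ≃ w_D(A)`, induced by evaluation. -/
noncomputable def torsionQuotOdotEquiv (hO : IsWPC D K (Odot 𝒮 A)) :
    torsionQuot D K (Odot 𝒮 A) ≃ₐ[D] wLower D K A :=
  ((torsionQuot D K (Odot 𝒮 A)).equivMapOfInjective
    ((odotEvalExt hi A).restrictScalars D)
    (odotEvalExt_injective hi A)).trans (Subalgebra.equivOfEq _ _ (by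
      rw [← range_odotEval hi hO, torsionQuot, ← AlgHom.range_comp]
      congr 1
      ext x
      simp [odotEvalExt_one_tmul]))

theorem coe_torsionQuotOdotEquiv_toTorsionQuot (hO : IsWPC D K (Odot 𝒮 A)) (x : Odot 𝒮 A) :
    (torsionQuotOdotEquiv hi hO (toTorsionQuot D K _ x) : K ⊗[D] A) = odotEval hi A x := by
  exact odotEvalExt_one_tmul hi x

/-- A homomorphism to a torsion-free algebra factors through `T`. -/
theorem exists_comp_toTorsionQuot_eq [Module.IsTorsionFree D B] (f : A →ₐ[D] B) :
    ∃ g : torsionQuot D K A →ₐ[D] B, g.comp (toTorsionQuot D K A) = f := by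
  refine ⟨AlgHom.liftOfSurjective (toTorsionQuot D K A) (toTorsionQuot_surjective A) f ?_, ?_⟩
  · intro a ha
    have h : (1 : K) ⊗ₜ[D] a = 0 := congrArg Subtype.val ha
    apply includeRight_injective_of_isTorsionFree (D := D) K B
    have h' := congrArg (Algebra.TensorProduct.map (AlgHom.id D K) f) h
    simpa using h'
  · exact AlgHom.liftOfSurjective_comp _ _ _ _

end Biring

end TorsionFree

/-! ### Algebras over a plethory structure on the ring of integer-valued polynomials -/

section IntPlethory

variable {D K : Type*} [CommRing D] [Field K] [Algebra D K]
  {Q : Plethory D (IntPoly D K)} (hQ : Q.unit = polyToInt D K)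
  {A B : Type*} [CommRing A] [Algebra D A] [CommRing B] [Algebra D B]

include hQ

theorem isBiringHom_polyToInt : IsBiringHom (polyBiring D) Q.toBiring (polyToInt D K) :=
  hQ ▸ Q.unit_isBiringHom

theorem PRing.act_intX (ρ : PRing Q A) (a : A) : ρ.act (Odot.mk _ (intX D K) a) = a := by
  rw [← polyToInt_X, ← hQ, ρ.unit_act]

theorem PRing.isWPC (ρ : PRing Q A) : IsWPC D K A := fun a =>
  ⟨ρ.act.comp (Odot.mkHom _ a), ρ.act_intX hQ a⟩

theorem isWPC_witt (R : Type*) [CommRing R] [Algebra D R] : IsWPC D K (Witt Q.toBiring R) :=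
  (PRing.witt Q R).isWPC hQ

theorem isWPC_odot (R : Type*) [CommRing R] [Algebra D R] : IsWPC D K (Odot Q.toBiring R) :=
  (PRing.odot Q R).isWPC hQ

theorem range_eval_isGreatest :
    IsGreatest {B : Subalgebra D A | IsWPC D K B}
      (Witt.eval (isBiringHom_polyToInt hQ) A).range := by
  refine ⟨(isWPC_witt hQ A).range _, fun C hC c hc => ?_⟩
  obtain ⟨φ, hφ⟩ := hC ⟨c, hc⟩
  refine ⟨Witt.of (C.val.comp φ), ?_⟩
  refine (eval_apply_intX (isBiringHom_polyToInt hQ) (Witt.of (C.val.comp φ))).trans ?_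
  exact congrArg Subtype.val hφ

theorem range_eval :
    (Witt.eval (isBiringHom_polyToInt hQ) A).range = wUpper D K A :=
  (range_eval_isGreatest hQ).isLUB.sSup_eq.symm

theorem torsionQuot_isWPC (R : Type*) [CommRing R] [Algebra D R] :
    IsWPC D K (torsionQuot D K (Odot Q.toBiring R)) := (isWPC_odot hQ R).range _

variable [IsDomain D] [IsFractionRing D K]

/-- Homomorphisms between `Int(D)`-rings with torsion-free target respect the actions. -/
theorem PRing.map_act [Module.IsTorsionFree D B] (ρ : PRing Q A) (σ : PRing Q B) (g : A →ₐ[D] B)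
    (f : IntPoly D K) (a : A) : g (ρ.act (Odot.mk _ f a)) = σ.act (Odot.mk _ f (g a)) := by
  refine DFunLike.congr_fun (f := (g.comp ρ.act).comp (Odot.mkHom _ a))
    (g := σ.act.comp (Odot.mkHom _ (g a))) (intPoly_hom_ext ?_) f
  simp only [AlgHom.comp_apply, Odot.mkHom_apply, PRing.act_intX hQ]

theorem PRing.subsingleton_of_isTorsionFree [Module.IsTorsionFree D A] :
    Subsingleton (PRing Q A) :=
  ⟨fun ρ σ => PRing.ext (Odot.hom_ext _ fun f a => ρ.map_act hQ σ (AlgHom.id D A) f a)⟩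

/-- The `Int(D)`-ring structure `f ∘ b = f (b)` of a torsion-free WPC algebra. -/
noncomputable def PRing.ofIsWPC [Module.IsTorsionFree D B] (hB : IsWPC D K B) : PRing Q B :=
  have hc := evalEquiv_symm_intX (isBiringHom_polyToInt hQ) hB
  PRing.ofCoaction Q (evalEquiv (isBiringHom_polyToInt hQ) hB).symm.toAlgHom
    (fun r a b => by
      refine DFunLike.congr_fun (f := (Witt.hom _).comp (Q.comp.comp (Odot.mkHom _ b)))
        (g := Witt.hom _) (intPoly_hom_ext ?_) a
      refine Eq.trans ?_ (hc _).symm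
      simp only [AlgHom.comp_apply, Odot.mkHom_apply]
      rw [← polyToInt_X, ← hQ, Q.unit_comp])
    (fun r => by rw [hQ, polyToInt_X]; exact hc r)

/-- For torsion-free `A`, evaluation at `X` identifies `W(A)` with `w^D(A)`. -/
noncomputable def wittEquivWUpper (A : Type*) [CommRing A] [Algebra D A]
    [Module.IsTorsionFree D A] : Witt Q.toBiring A ≃ₐ[D] wUpper D K A :=
  (AlgEquiv.ofInjective _ (eval_injective (isBiringHom_polyToInt hQ))).trans
    (Subalgebra.equivOfEq _ _ (range_eval hQ))

theorem coe_wittEquivWUpper [Module.IsTorsionFree D A] (φ : Witt Q.toBiring A) :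
    (wittEquivWUpper hQ A φ : A) = φ.hom (intX D K) :=
  eval_apply_intX (isBiringHom_polyToInt hQ) φ

/-- Homomorphisms from a torsion-free WPC algebra to `R` lift uniquely to `W(R)` as soon as `W(R)`
is torsion-free: a lift respects the `Int(D)`-ring structures, and an element `φ` of `W(R)` is
recovered from the values at `X` of the elements `f ∘ φ`. -/
theorem eval_comp_bijective [Module.IsTorsionFree D B] (hB : IsWPC D K B)
    (R : Type*) [CommRing R] [Algebra D R] (hR : Module.IsTorsionFree D (Witt Q.toBiring R)) :
    Function.Bijective fun g : B →ₐ[D] Witt Q.toBiring R =>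
      (Witt.eval (isBiringHom_polyToInt hQ) R).comp g := by
  have hi := isBiringHom_polyToInt hQ
  constructor
  · have key : ∀ (g : B →ₐ[D] Witt Q.toBiring R) (b : B) (f : IntPoly D K),
        (g b).hom f = Witt.eval hi R (g ((PRing.ofIsWPC hQ hB).act (Odot.mk _ f b))) := by
      intro g b f
      rw [PRing.map_act hQ _ (PRing.witt Q R), eval_apply_intX, PRing.witt_act_mk,
        ← polyToInt_X, ← hQ, Q.unit_comp]
    intro g g' h
    ext b
    apply Witt.hom_injective
    ext f
    rw [key, key]
    exact DFunLike.congr_fun h _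
  · intro g
    refine ⟨(Witt.map Q.toBiring g).comp (evalEquiv hi hB).symm.toAlgHom, ?_⟩
    ext b
    change Witt.eval hi R (Witt.map Q.toBiring g ((evalEquiv hi hB).symm b)) = g b
    rw [eval_apply_intX]
    exact congrArg g (evalEquiv_symm_intX hi hB b)

/-- Homomorphisms from `R` to a torsion-free WPC algebra extend uniquely to `Int(D) ⊙ R`. -/
theorem comp_odotUnit_bijective [Module.IsTorsionFree D B] (hB : IsWPC D K B)
    (R : Type*) [CommRing R] [Algebra D R] :
    Function.Bijective fun g : Odot Q.toBiring R →ₐ[D] B =>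
      g.comp (odotUnit (isBiringHom_polyToInt hQ) R) := by
  have hi := isBiringHom_polyToInt hQ
  constructor
  · intro g g' h
    refine Odot.hom_ext _ fun f r => ?_
    refine DFunLike.congr_fun (f := g.comp (Odot.mkHom _ r)) (g := g'.comp (Odot.mkHom _ r))
      (intPoly_hom_ext ?_) f
    simp only [AlgHom.comp_apply, Odot.mkHom_apply, ← odotUnit_apply hi]
    exact DFunLike.congr_fun h r
  · intro g
    refine ⟨Odot.lift _ ((evalEquiv hi hB).symm.toAlgHom.comp g), ?_⟩
    ext r
    simp only [AlgHom.comp_apply, odotUnit_apply, Odot.lift_mk]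
    exact evalEquiv_symm_intX hi hB (g r)

theorem comp_toTorsionQuot_odotUnit_bijective [Module.IsTorsionFree D B] (hB : IsWPC D K B)
    (R : Type*) [CommRing R] [Algebra D R] :
    Function.Bijective fun g : torsionQuot D K (Odot Q.toBiring R) →ₐ[D] B =>
      g.comp ((toTorsionQuot D K _).comp (odotUnit (isBiringHom_polyToInt hQ) R)) := by
  refine (comp_odotUnit_bijective hQ hB R).comp
    (f := fun g : torsionQuot D K (Odot Q.toBiring R) →ₐ[D] B => g.comp (toTorsionQuot D K _))
    ⟨fun g g' h => ?_, exists_comp_toTorsionQuot_eq⟩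
  ext x
  obtain ⟨y, rfl⟩ := toTorsionQuot_surjective _ x
  exact DFunLike.congr_fun h y

/-- A torsion-free WPC algebra is its own `T(Int(D) ⊙ A)`, since it is its own `w_D(A)`. -/
theorem toTorsionQuot_odotUnit_bijective [Module.IsTorsionFree D A] (hA : IsWPC D K A) :
    Function.Bijective
      ((toTorsionQuot D K _).comp (odotUnit (isBiringHom_polyToInt hQ) A)) := by
  have hi := isBiringHom_polyToInt hQ
  set e := torsionQuotOdotEquiv hi (isWPC_odot hQ A)
  have he : ∀ a, (e (toTorsionQuot D K _ (odotUnit hi A a)) : K ⊗[D] A) = (1 : K) ⊗ₜ a := by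
    intro a
    rw [coe_torsionQuotOdotEquiv_toTorsionQuot, odotUnit_apply, odotEval_mk]
    exact Polynomial.aeval_X _
  constructor
  · intro a a' h
    apply includeRight_injective_of_isTorsionFree (D := D) K A
    have h' := congrArg (fun x => (e x : K ⊗[D] A)) h
    simp only [AlgHom.comp_apply, he] at h'
    exact h'
  · intro x
    obtain ⟨a, ha⟩ : (e x : K ⊗[D] A) ∈
        (Algebra.TensorProduct.includeRight : A →ₐ[D] K ⊗[D] A).range :=
      (isLeast_wLower A).2 ⟨le_rfl, hA.range _⟩ (e x).2
    refine ⟨a, e.injective (Subtype.ext ?_)⟩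
    rw [AlgHom.comp_apply, he]
    exact ha

end IntPlethory

/-! ### Adjoints of the inclusion -/

section Adjoints

/-- An endofunctor with values in a full subcategory and a natural transformation to the identity
through which morphisms from the subcategory factor uniquely is a coreflection. -/
theorem nonempty_adjunction_ι_lift {C : Type*} [Category C] (P : ObjectProperty C) (F : C ⥤ C)
    (h : ∀ R, P (F.obj R)) (ε : F ⟶ 𝟭 C)
    (hε : ∀ B R, P B → Function.Bijective fun g : B ⟶ F.obj R => g ≫ ε.app R) :
    Nonempty (P.ι ⊣ P.lift F h) := by
  let e (X : P.FullSubcategory) (Y : C) : (X ⟶ (P.lift F h).obj Y) ≃ (P.ι.obj X ⟶ Y) :=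
    Equiv.ofBijective (fun g => g.hom ≫ ε.app Y)
      ((hε X.obj Y X.property).comp (P.fullyFaithfulι.homEquiv).bijective)
  refine ⟨Adjunction.mkOfHomEquiv
    { homEquiv := fun X Y => (e X Y).symm
      homEquiv_naturality_left_symm := fun f g => Category.assoc _ _ _
      homEquiv_naturality_right := fun {X Y Y'} f g => ?_ }⟩
  rw [Equiv.symm_apply_eq]
  obtain ⟨f, rfl⟩ := (e X Y).surjective f
  rw [Equiv.symm_apply_apply]
  have hn : F.map g ≫ ε.app Y' = ε.app Y ≫ g := ε.naturality g
  simp [e, hn]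

/-- An endofunctor with values in a full subcategory and a natural transformation from the identity
through which morphisms to the subcategory factor uniquely is a reflection. -/
theorem nonempty_adjunction_lift_ι {C : Type*} [Category C] (P : ObjectProperty C) (F : C ⥤ C)
    (h : ∀ R, P (F.obj R)) (η : 𝟭 C ⟶ F)
    (hη : ∀ B R, P B → Function.Bijective fun g : F.obj R ⟶ B => η.app R ≫ g) :
    Nonempty (P.lift F h ⊣ P.ι) := by
  let e (Y : C) (X : P.FullSubcategory) : ((P.lift F h).obj Y ⟶ X) ≃ (Y ⟶ P.ι.obj X) :=
    Equiv.ofBijective (fun g => η.app Y ≫ g.hom)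
      ((hη X.obj Y X.property).comp (P.fullyFaithfulι.homEquiv).bijective)
  refine ⟨Adjunction.mkOfHomEquiv
    { homEquiv := e
      homEquiv_naturality_left_symm := fun {X' X Y} f g => ?_
      homEquiv_naturality_right := fun f g => (Category.assoc _ _ _).symm }⟩
  rw [Equiv.symm_apply_eq]
  obtain ⟨g, rfl⟩ := (e X Y).surjective g
  rw [Equiv.symm_apply_apply]
  have hn : η.app X' ≫ F.map f = f ≫ η.app X := (η.naturality f).symm
  simp [e, reassoc_of% hn]

variable {D K : Type u} [CommRing D] [IsDomain D] [Field K] [Algebra D K] [IsFractionRing D K]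
  {Q : Plethory D (IntPoly D K)} (hQ : Q.unit = polyToInt D K)

theorem ofHom_bijective {R A B : Type u} [CommRing R] [CommRing A] [Algebra R A] [CommRing B]
    [Algebra R B] :
    Function.Bijective (CommAlgCat.ofHom : (A →ₐ[R] B) → (CommAlgCat.of R A ⟶ CommAlgCat.of R B)) :=
  ⟨fun _ _ h => congrArg CommAlgCat.Hom.hom h, fun f => ⟨f.hom, rfl⟩⟩

include hQ

theorem isRightAdjointOfInclusion_witt
    (h : ∀ (R : Type u) [CommRing R] [Algebra D R], Module.IsTorsionFree D (Witt Q.toBiring R)) :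
    IsRightAdjointOfInclusion D K (wittFunctor Q.toBiring) := by
  have hi := isBiringHom_polyToInt hQ
  refine ⟨fun R => ⟨h R, isWPC_witt hQ R⟩, nonempty_adjunction_ι_lift _ _ _
    { app := fun R => CommAlgCat.ofHom (Witt.eval hi R)
      naturality := fun R R' f => rfl } fun B R hB => ?_⟩
  have := hB.1
  have hb := ofHom_bijective.comp (eval_comp_bijective hQ hB.2 R (h R))
  exact (Function.Bijective.of_comp_iff _ ofHom_bijective).1 hb

theorem isLeftAdjointOfInclusion_odot
    (h : ∀ (R : Type u) [CommRing R] [Algebra D R], Module.IsTorsionFree D (Odot Q.toBiring R)) :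
    IsLeftAdjointOfInclusion D K (odotFunctor Q.toBiring) := by
  have hi := isBiringHom_polyToInt hQ
  refine ⟨fun R => ⟨h R, isWPC_odot hQ R⟩, nonempty_adjunction_lift_ι _ _ _
    { app := fun R => CommAlgCat.ofHom (odotUnit hi R)
      naturality := fun R R' f => ?_ } fun B R hB => ?_⟩
  · ext x
    change odotUnit hi R' (f.hom x) = Odot.map _ f.hom (odotUnit hi R x)
    rw [odotUnit_apply, odotUnit_apply, Odot.map_mk]
  · have := hB.1
    have hb := ofHom_bijective.comp (comp_odotUnit_bijective hQ hB.2 R)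
    exact (Function.Bijective.of_comp_iff _ ofHom_bijective).1 hb

theorem isLeftAdjointOfInclusion_torsionQuot_odot :
    IsLeftAdjointOfInclusion D K (odotFunctor Q.toBiring ⋙ torsionQuotFunctor D K) := by
  have hi := isBiringHom_polyToInt hQ
  refine ⟨fun R => ⟨inferInstanceAs (Module.IsTorsionFree D (torsionQuot D K (Odot Q.toBiring R))),
    torsionQuot_isWPC hQ R⟩, nonempty_adjunction_lift_ι _ _ _
    { app := fun R => CommAlgCat.ofHom ((toTorsionQuot D K _).comp (odotUnit hi R))
      naturality := fun R R' f => ?_ } fun B R hB => ?_⟩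
  · ext x
    refine Subtype.ext ?_
    change (1 : K) ⊗ₜ[D] odotUnit hi R' (f.hom x) = Algebra.TensorProduct.map (AlgHom.id D K)
      (Odot.map _ f.hom) ((1 : K) ⊗ₜ[D] odotUnit hi R x)
    rw [odotUnit_apply, odotUnit_apply, Algebra.TensorProduct.map_tmul, Odot.map_mk, map_one]
  · have := hB.1
    have hb := ofHom_bijective.comp (comp_toTorsionQuot_odotUnit_bijective hQ hB.2 R)
    exact (Function.Bijective.of_comp_iff _ ofHom_bijective).1 hb

end Adjoints

/-! ### The functors on torsion-free algebras -/

section FunctorIso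

variable {D K : Type u} [CommRing D] [IsDomain D] [Field K] [Algebra D K] [IsFractionRing D K]
  {Q : Plethory D (IntPoly D K)} (hQ : Q.unit = polyToInt D K)

include hQ

theorem exists_wittFunctor_iso_wUpperFunctor :
    ∃ e : (torsionFree D).ι ⋙ wittFunctor Q.toBiring ≅ (torsionFree D).ι ⋙ wUpperFunctor D K,
      ∀ (A : (torsionFree D).FullSubcategory) (φ : Witt Q.toBiring A.obj),
        ((e.hom.app A).hom φ : wUpper D K A.obj).1 = φ.hom (intX D K) := by
  have htf (A : (torsionFree D).FullSubcategory) : Module.IsTorsionFree D A.obj := A.property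
  refine ⟨NatIso.ofComponents (fun A => CommAlgCat.isoMk (wittEquivWUpper hQ A.obj))
    fun {A B} f => ?_, fun A φ => coe_wittEquivWUpper hQ φ⟩
  ext φ
  refine Subtype.ext ?_
  exact (coe_wittEquivWUpper (A := B.obj) hQ _).trans
    (congrArg f.hom.hom (coe_wittEquivWUpper (A := A.obj) hQ φ).symm)

theorem exists_odotFunctor_iso_wLowerFunctor :
    ∃ e : (torsionFree D).ι ⋙ odotFunctor Q.toBiring ⋙ torsionQuotFunctor D K ≅
        (torsionFree D).ι ⋙ wLowerFunctor D K,
      ∀ (A : (torsionFree D).FullSubcategory) (f : IntPoly D K) (a : A.obj),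
        ((e.hom.app A).hom (toTorsionQuot D K _ (Odot.mk Q.toBiring f a)) : wLower D K A.obj).1 =
          Polynomial.aeval ((1 : K) ⊗ₜ[D] a) (f : Polynomial K) := by
  have hi := isBiringHom_polyToInt hQ
  refine ⟨NatIso.ofComponents (fun A => CommAlgCat.isoMk
    (torsionQuotOdotEquiv hi (isWPC_odot hQ A.obj))) fun {A B} f => ?_, fun A g a => ?_⟩
  · ext x
    obtain ⟨y, rfl⟩ := toTorsionQuot_surjective (Odot Q.toBiring A.obj) x
    refine Subtype.ext ?_
    change (torsionQuotOdotEquiv hi (isWPC_odot hQ B.obj) (toTorsionQuot D K _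
      (Odot.map Q.toBiring f.hom.hom y))).1 = Algebra.TensorProduct.map (AlgHom.id D K) f.hom.hom
        (torsionQuotOdotEquiv hi (isWPC_odot hQ A.obj) (toTorsionQuot D K _ y)).1
    rw [coe_torsionQuotOdotEquiv_toTorsionQuot, coe_torsionQuotOdotEquiv_toTorsionQuot]
    exact DFunLike.congr_fun (odotEval_comp_map hi f.hom.hom) y
  · exact (coe_torsionQuotOdotEquiv_toTorsionQuot hi _ _).trans (odotEval_mk hi g a)

end FunctorIso

/-! ### Principal ideal domains with finite residue fields -/

section PID

variable {D K : Type*} [CommRing D] [IsDomain D] [Field K] [Algebra D K] [IsFractionRing D K]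
  {Q : Plethory D (IntPoly D K)} (hQ : Q.unit = polyToInt D K)
  {A : Type*} [CommRing A] [Algebra D A]

include hQ in
/-- A prime `p` of finite residue field, with `q` elements, acts injectively on an `Int(D)`-ring.
Put `f = (X ^ q - X) / p`, which is in `Int(D)`. If `p a = 0`, then `f ∘ (p a) = f (0) = 0`, whereas
`f (p X) = p ^ (q - 1) X ^ q - X` gives `f ∘ (p a) = - a`. -/
theorem PRing.eq_zero_of_prime_smul_eq_zero (ρ : PRing Q A) {p : D} (hp : Prime p)
    [(Ideal.span {p}).IsMaximal] [Finite (D ⧸ Ideal.span {p})] {a : A} (ha : p • a = 0) :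
    a = 0 := by
  classical
  let _ := Ideal.Quotient.field (Ideal.span {p})
  have := Fintype.ofFinite (D ⧸ Ideal.span {p})
  set q := Fintype.card (D ⧸ Ideal.span {p}) with hq
  have hq1 : 1 < q := Fintype.one_lt_card
  have hpK : algebraMap D K p ≠ 0 := by simpa using hp.ne_zero
  -- the integer-valued polynomial `(X ^ q - X) / p`
  let f : IntPoly D K := ⟨Polynomial.C (algebraMap D K p)⁻¹ * (Polynomial.X ^ q - Polynomial.X),
    fun d => by
      have hd : d ^ q - d ∈ Ideal.span {p} := by
        rw [← Ideal.Quotient.eq_zero_iff_mem, map_sub, map_pow, FiniteField.pow_card, sub_self]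
      obtain ⟨c, hc⟩ := Ideal.mem_span_singleton.1 hd
      refine ⟨c, ?_⟩
      have hc' := congrArg (algebraMap D K) hc
      simp only [map_sub, map_pow, map_mul] at hc'
      simp [hc', hpK]⟩
  have hpf : p • f = intX D K ^ q - intX D K := by
    apply Subtype.ext
    change p • (Polynomial.C (algebraMap D K p)⁻¹ * (Polynomial.X ^ q - Polynomial.X)) =
      Polynomial.X ^ q - (Polynomial.X : Polynomial K)
    rw [← algebraMap_smul K p, Polynomial.smul_eq_C_mul, ← mul_assoc, ← Polynomial.C_mul,
      mul_inv_cancel₀ hpK, Polynomial.C_1, one_mul]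
  -- the composition `f (p X)`
  have hcomp : Q.comp (Odot.mk _ f (p • intX D K)) =
      p ^ (q - 1) • intX D K ^ q - intX D K := by
    apply smul_right_injective _ hp.ne_zero
    have h1 : ∀ g : IntPoly D K, Q.comp (Odot.mk _ (intX D K) g) = g := fun g => by
      rw [← polyToInt_X, ← hQ, Q.unit_comp]
    have h2 := map_smul (Q.comp.comp (Odot.mkHom Q.toBiring (p • intX D K))) p f
    simp only [hpf, map_sub, map_pow, AlgHom.comp_apply, Odot.mkHom_apply, h1] at h2
    change p • Q.comp _ = p • _
    rw [← h2, smul_pow, smul_sub, smul_smul, ← pow_succ', Nat.sub_add_cancel hq1.le]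
  have hzero : ρ.act (Odot.mk _ f 0) = 0 := by
    have h := Odot.proj_rel (OdotRel.right_scalar (𝒮 := Q.toBiring) (R := A) f 0)
    rw [map_zero] at h
    have h0 : Q.colin 0 f = 0 := by
      apply smul_right_injective D hp.ne_zero
      have hX : Q.colin 0 (intX D K) = 0 := by
        rw [← polyToInt_X]
        exact (isBiringHom_polyToInt hQ).colin_X 0
      change p • Q.colin 0 f = p • 0
      rw [← map_smul, hpf, map_sub, map_pow, hX, zero_pow (by lia), sub_zero, smul_zero]
    rw [h0, map_zero, map_zero] at h
    change ρ.act (Odot.proj _ _) = 0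
    rw [h, map_zero]
  have hX : ρ.act (Odot.mk _ (p • intX D K) a) = 0 := by
    have h := map_smul (ρ.act.comp (Odot.mkHom Q.toBiring a)) p (intX D K)
    simp only [AlgHom.comp_apply, Odot.mkHom_apply, ρ.act_intX hQ, ha] at h
    exact h
  have h := ρ.act_act f (p • intX D K) a
  rw [hX, hzero, hcomp] at h
  change (ρ.act.comp (Odot.mkHom Q.toBiring a)) _ = 0 at h
  have hact : (ρ.act.comp (Odot.mkHom Q.toBiring a)) (intX D K) = a := ρ.act_intX hQ a
  have hpa : p ^ (q - 1) • a ^ q = 0 := by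
    obtain ⟨k, hk⟩ := Nat.exists_eq_add_of_lt hq1
    rw [hk, show 1 + k + 1 - 1 = k + 1 by lia, pow_succ a, pow_succ, ← smul_smul,
      ← mul_smul_comm, ha, mul_zero, smul_zero]
  rw [map_sub, map_smul, map_pow, hact, hpa, zero_sub, neg_eq_zero] at h
  exact h

include hQ in
theorem PRing.isTorsionFree [IsPrincipalIdealRing D]
    (hD : ∀ m : Ideal D, m.IsMaximal → Finite (D ⧸ m)) (ρ : PRing Q A) :
    Module.IsTorsionFree D A := by
  refine .of_smul_eq_zero fun r => ?_
  induction r using UniqueFactorizationMonoid.induction_on_prime with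
  | h₁ => exact fun _ _ => .inl rfl
  | h₂ u hu => exact fun m hm => .inr ((hu.smul_eq_zero).1 hm)
  | h₃ r p hr hp ih =>
    intro m hm
    have hmax : (Ideal.span {p}).IsMaximal :=
      PrincipalIdealRing.isMaximal_of_irreducible hp.irreducible
    have := hD _ hmax
    rw [mul_smul] at hm
    rcases ih m (ρ.eq_zero_of_prime_smul_eq_zero hQ hp hm) with h | h
    · exact absurd h hr
    · exact .inr h

end PID

/-! ### Existence of the plethory structure -/

section OdotCoop

variable {A S T : Type*} [CommRing A] [CommRing S] [Algebra A S] [CommRing T] [Algebra A T]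
  (𝒮 : Biring A S) (𝒯 : Biring A T) {s : S} {t : T}

theorem odotCoadd_mk_of_primitive (hs : 𝒮.coadd s = s ⊗ₜ 1 + 1 ⊗ₜ s)
    (ht : 𝒯.coadd t = t ⊗ₜ 1 + 1 ⊗ₜ t) :
    odotCoadd 𝒮 𝒯 (Odot.mk 𝒮 s t) = Odot.mk 𝒮 s t ⊗ₜ 1 + 1 ⊗ₜ Odot.mk 𝒮 s t := by
  rw [← conv_incl (odotCoadd 𝒮 𝒯)]
  change ((odotPoints 𝒮 𝒯 (conv (odotCoadd 𝒮 𝒯) _ _)).hom t).hom s = _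
  rw [odotPoints_coadd, Witt.hom_add, conv_apply_of_primitive ht, Witt.hom_add,
    conv_apply_of_primitive hs]
  rfl

theorem odotComul_mk_of_groupLike (hs : 𝒮.comul s = s ⊗ₜ s) (ht : 𝒯.comul t = t ⊗ₜ t) :
    odotComul 𝒮 𝒯 (Odot.mk 𝒮 s t) = Odot.mk 𝒮 s t ⊗ₜ Odot.mk 𝒮 s t := by
  rw [← conv_incl (odotComul 𝒮 𝒯)]
  change ((odotPoints 𝒮 𝒯 (conv (odotComul 𝒮 𝒯) _ _)).hom t).hom s = _
  rw [odotPoints_comul, Witt.hom_mul, conv_apply_of_groupLike ht, Witt.hom_mul,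
    conv_apply_of_groupLike hs]
  change (Odot.mk 𝒮 s t ⊗ₜ[A] 1) * (1 ⊗ₜ[A] Odot.mk 𝒮 s t) = _
  simp

theorem odotColin_mk (a : A) (hs : ∀ a, 𝒮.colin a s = a) (ht : 𝒯.colin a t = a) :
    odotColin 𝒮 𝒯 a (Odot.mk 𝒮 s t) = a := by
  change ((odotPoints 𝒮 𝒯 (odotColin 𝒮 𝒯 a)).hom t).hom s = a
  rw [odotColin, Equiv.apply_symm_apply, Witt.hom_algebraMap, AlgHom.comp_apply, ht,
    Algebra.ofId_apply, Witt.hom_algebraMap, AlgHom.comp_apply, hs]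
  rfl

end OdotCoop

section WPC

variable {D K : Type*} [CommRing D] [Field K] [Algebra D K]

/-- A homomorphism from `Int(D)` to a WPC algebra with a given value at `X`. -/
noncomputable def IsWPC.hom {B : Type*} [CommRing B] [Algebra D B] (h : IsWPC D K B) (b : B) :
    IntPoly D K →ₐ[D] B := (h b).choose

theorem IsWPC.hom_intX {B : Type*} [CommRing B] [Algebra D B] (h : IsWPC D K B) (b : B) :
    h.hom b (intX D K) = b := (h b).choose_spec

theorem IsWPC.of_surjective {A B : Type*} [CommRing A] [Algebra D A] [CommRing B] [Algebra D B]
    (h : IsWPC D K A) (f : A →ₐ[D] B) (hf : Function.Surjective f) : IsWPC D K B := by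
  intro b
  obtain ⟨a, rfl⟩ := hf b
  obtain ⟨φ, rfl⟩ := h a
  exact ⟨f.comp φ, rfl⟩

variable [IsDomain D] [IsFractionRing D K]

theorem IsWPC.hom_apply {L : Type*} [CommRing L] [Algebra D L] [Algebra K L] [IsScalarTower D K L]
    (h : IsWPC D K L) (x : L) (f : IntPoly D K) :
    h.hom x f = Polynomial.aeval x (f : Polynomial K) := by
  rw [intPoly_hom_eq_aeval, h.hom_intX]

theorem isWPC_intPoly : IsWPC D K (IntPoly D K) := by
  rw [isWPC_subalgebra_iff]
  intro f hf g hg d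
  obtain ⟨c, hc⟩ := hg d
  rw [← Polynomial.comp_eq_aeval, Polynomial.eval_comp, ← hc]
  exact hf c

variable (D K) in
theorem isWPC_self : IsWPC D K D := by
  have h : IsWPC D K (Algebra.ofId D K).range := by
    rw [isWPC_subalgebra_iff]
    rintro f hf _ ⟨d, rfl⟩
    change Polynomial.aeval (algebraMap D K d) f ∈ _
    rw [Polynomial.coe_aeval_eq_eval]
    exact hf d
  have e := AlgEquiv.ofInjective (Algebra.ofId D K) (IsFractionRing.injective D K)
  exact h.of_surjective e.symm.toAlgHom e.symm.surjective

/-- `f ⊗ g ↦ f (Xᵢ) g (Xⱼ)`. -/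
noncomputable def intPolyTensorEval {σ : Type*} (i j : σ) :
    IntPoly D K ⊗[D] IntPoly D K →ₐ[D] MvPolynomial σ K :=
  Algebra.TensorProduct.productMap
    ((isWPC_of_fractionField_algebra (MvPolynomial σ K)).hom (MvPolynomial.X i))
    ((isWPC_of_fractionField_algebra (MvPolynomial σ K)).hom (MvPolynomial.X j))

theorem exists_smul_mem_range_map_polyToInt (t : IntPoly D K ⊗[D] IntPoly D K) :
    ∃ b : D, b ≠ 0 ∧
      ∃ y, Algebra.TensorProduct.map (polyToInt D K) (polyToInt D K) y = b • t := by
  induction t with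
  | zero => exact ⟨1, one_ne_zero, 0, by simp⟩
  | tmul f g =>
    obtain ⟨b, hb, f', hf⟩ := exists_smul_mem_range_polyToInt f
    obtain ⟨c, hc, g', hg⟩ := exists_smul_mem_range_polyToInt g
    refine ⟨b * c, mul_ne_zero hb hc, f' ⊗ₜ g', ?_⟩
    rw [Algebra.TensorProduct.map_tmul, hf, hg, smul_tmul_smul]
  | add x y hx hy =>
    obtain ⟨b, hb, x', hx⟩ := hx
    obtain ⟨c, hc, y', hy⟩ := hy
    refine ⟨b * c, mul_ne_zero hb hc, c • x' + b • y', ?_⟩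
    rw [map_add, map_smul, map_smul, hx, hy, smul_add, smul_smul, smul_smul, mul_comm c]

/-- If `Int(D) ⊗ Int(D)` is torsion-free it is a ring of polynomials in two variables: after
clearing denominators this is the isomorphism `D[X] ⊗ D[Y] ≃ D[X, Y]`. -/
theorem intPolyTensorEval_injective [Module.IsTorsionFree D (IntPoly D K ⊗[D] IntPoly D K)]
    {σ : Type*} {i j : σ} (hij : i ≠ j) :
    Function.Injective (intPolyTensorEval (D := D) (K := K) i j) := by
  classical
  rw [injective_iff_map_eq_zero]
  intro t ht
  obtain ⟨b, hb, y, hy⟩ := exists_smul_mem_range_map_polyToInt t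
  let α : Polynomial D ⊗[D] Polynomial D →ₐ[D] MvPolynomial σ D :=
    Algebra.TensorProduct.productMap (Polynomial.aeval (MvPolynomial.X i))
      (Polynomial.aeval (MvPolynomial.X j))
  let β : MvPolynomial σ D →ₐ[D] Polynomial D ⊗[D] Polynomial D :=
    MvPolynomial.aeval fun k => if k = i then Polynomial.X ⊗ₜ 1 else 1 ⊗ₜ Polynomial.X
  have hβα : β.comp α = AlgHom.id D _ := by ext <;> simp [α, β, hij.symm]
  have hα : (MvPolynomial.mapAlgHom (Algebra.ofId D K)).comp α =
      (intPolyTensorEval i j).comp (Algebra.TensorProduct.map (polyToInt D K) (polyToInt D K)) := by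
    ext <;> simp [α, intPolyTensorEval, polyToInt_X, IsWPC.hom_intX]
  have hαy : α y = 0 := by
    apply MvPolynomial.map_injective _ (IsFractionRing.injective D K)
    rw [map_zero]
    refine (DFunLike.congr_fun hα y).trans ?_
    rw [AlgHom.comp_apply, hy]
    refine (map_smul (intPolyTensorEval i j) b t).trans ?_
    rw [ht, smul_zero]
  have hy0 : y = 0 := by
    have h := DFunLike.congr_fun hβα y
    rw [AlgHom.comp_apply, hαy, map_zero] at h
    exact h.symm
  rw [hy0, map_zero] at hy
  exact (smul_eq_zero_iff_right hb).1 hy.symm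

theorem range_intPolyTensorEval {σ : Type*} {i j : σ} (hσ : ∀ k, k = i ∨ k = j) :
    (intPolyTensorEval (D := D) (K := K) i j).range = intTensor D K σ := by
  refine le_antisymm ?_ (Algebra.adjoin_le ?_)
  · rintro _ ⟨t, rfl⟩
    change intPolyTensorEval i j t ∈ _
    induction t with
    | zero => rw [map_zero]; exact zero_mem _
    | tmul f g =>
      rw [intPolyTensorEval, Algebra.TensorProduct.productMap_apply_tmul, IsWPC.hom_apply,
        IsWPC.hom_apply]
      exact mul_mem (Algebra.subset_adjoin ⟨f, f.2, _, rfl⟩)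
        (Algebra.subset_adjoin ⟨g, g.2, _, rfl⟩)
    | add x y hx hy =>
      rw [map_add]
      exact add_mem hx hy
  · rintro _ ⟨f, hf, k, rfl⟩
    rcases hσ k with rfl | rfl
    · refine ⟨⟨f, hf⟩ ⊗ₜ 1, ?_⟩
      simp [intPolyTensorEval, IsWPC.hom_apply]
    · refine ⟨1 ⊗ₜ ⟨f, hf⟩, ?_⟩
      simp [intPolyTensorEval, IsWPC.hom_apply]

theorem isWPC_intWeak (σ : Type*) : IsWPC D K (intWeak D K σ) := by
  rw [isWPC_subalgebra_iff]
  intro f hf x hx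
  exact Algebra.mem_sInf.2 fun B hB => hB.2 f hf x (Algebra.mem_sInf.1 hx B hB)

end WPC

section Existence

variable {D K : Type*} [CommRing D] [IsDomain D] [Field K] [Algebra D K] [IsFractionRing D K]

theorem isWPC_intPoly_tensor {D K : Type u} [CommRing D] [IsDomain D] [Field K] [Algebra D K]
    [IsFractionRing D K] [Module.IsTorsionFree D (IntPoly D K ⊗[D] IntPoly D K)]
    (hw : IsWeaklyPolynomiallyComposite D K) : IsWPC D K (IntPoly D K ⊗[D] IntPoly D K) := by
  have h := isWPC_intWeak (D := D) (K := K) (ULift.{u} Bool)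
  rw [← hw, ← range_intPolyTensorEval (i := ⟨false⟩) (j := ⟨true⟩)
    (by rintro ⟨_ | _⟩ <;> simp)] at h
  have e := AlgEquiv.ofInjective _ (intPolyTensorEval_injective (D := D) (K := K)
    (i := ULift.up.{u} false) (j := ⟨true⟩) (by simp))
  exact h.of_surjective e.symm.toAlgHom e.symm.surjective

variable (hT : IsWPC D K (IntPoly D K ⊗[D] IntPoly D K))

/-- The biring structure on `Int(D)` in which `X` is primitive for co-addition and group-like for
co-multiplication. The laws are equalities of homomorphisms to torsion-free algebras, so they need
to be checked on `X` only. -/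
noncomputable def intBiring
    [Module.IsTorsionFree D (IntPoly D K ⊗[D] IntPoly D K)]
    [Module.IsTorsionFree D (IntPoly D K ⊗[D] (IntPoly D K ⊗[D] IntPoly D K))] :
    Biring D (IntPoly D K) :=
  have hadd := hT.hom_intX (intX D K ⊗ₜ 1 + 1 ⊗ₜ intX D K)
  have hmul := hT.hom_intX (intX D K ⊗ₜ intX D K)
  { coadd := hT.hom (intX D K ⊗ₜ 1 + 1 ⊗ₜ intX D K)
    comul := hT.hom (intX D K ⊗ₜ intX D K)
    coneg := isWPC_intPoly.hom (-intX D K)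
    colin := fun a => (isWPC_self D K).hom a
    coadd_assoc := intPoly_hom_ext (by simp [conv_apply_of_primitive hadd, add_assoc])
    coadd_comm := intPoly_hom_ext (by
      rw [AlgHom.comp_apply, hadd]
      simp [add_comm])
    coadd_zero := intPoly_hom_ext (by simp [conv_apply_of_primitive hadd, IsWPC.hom_intX])
    coadd_neg := intPoly_hom_ext (by simp [conv_apply_of_primitive hadd, IsWPC.hom_intX])
    comul_assoc := intPoly_hom_ext (by simp [conv_apply_of_groupLike hmul, mul_assoc])
    comul_comm := intPoly_hom_ext (by simp [hmul])
    comul_one := intPoly_hom_ext (by simp [conv_apply_of_groupLike hmul, IsWPC.hom_intX])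
    codistrib := intPoly_hom_ext (by
      simp [conv_apply_of_primitive hadd, conv_apply_of_groupLike hmul, mul_add])
    colin_add := fun a b => intPoly_hom_ext (by
      simp [conv_apply_of_primitive hadd, IsWPC.hom_intX])
    colin_mul := fun a b => intPoly_hom_ext (by
      simp [conv_apply_of_groupLike hmul, IsWPC.hom_intX]) }

theorem isBiringHom_intBiring
    [Module.IsTorsionFree D (IntPoly D K ⊗[D] IntPoly D K)]
    [Module.IsTorsionFree D (IntPoly D K ⊗[D] (IntPoly D K ⊗[D] IntPoly D K))] :
    IsBiringHom (polyBiring D) (intBiring hT) (polyToInt D K) where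
  map_coadd := by
    apply Polynomial.algHom_ext
    simp [polyBiring, intBiring, polyToInt_X, IsWPC.hom_intX]
  map_comul := by
    apply Polynomial.algHom_ext
    simp [polyBiring, intBiring, polyToInt_X, IsWPC.hom_intX]
  map_colin a := by
    apply Polynomial.algHom_ext
    simp [polyBiring, intBiring, polyToInt_X, IsWPC.hom_intX]

variable {𝒮 : Biring D (IntPoly D K)} (hi : IsBiringHom (polyBiring D) 𝒮 (polyToInt D K))

include hi in
theorem odot_intPoly_hom_ext {B : Type*} [CommRing B] [Algebra D B] [Module.IsTorsionFree D B]
    {φ ψ : Odot 𝒮 (IntPoly D K) →ₐ[D] B}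
    (h : φ (Odot.mk 𝒮 (intX D K) (intX D K)) = ψ (Odot.mk 𝒮 (intX D K) (intX D K))) : φ = ψ := by
  have h1 : φ.comp (odotUnit hi _) = ψ.comp (odotUnit hi _) := intPoly_hom_ext (by
    simp only [AlgHom.comp_apply, odotUnit_apply, h])
  refine Odot.hom_ext 𝒮 fun f g => ?_
  refine DFunLike.congr_fun (f := φ.comp (Odot.mkHom 𝒮 g)) (g := ψ.comp (Odot.mkHom 𝒮 g))
    (intPoly_hom_ext ?_) f
  have h2 := DFunLike.congr_fun h1 g
  simp only [AlgHom.comp_apply, odotUnit_apply] at h2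
  exact h2

/-- Composition of integer-valued polynomials, `f ⊙ g ↦ f (g)`. -/
noncomputable def intComp : Odot 𝒮 (IntPoly D K) →ₐ[D] IntPoly D K :=
  Odot.lift 𝒮 (evalEquiv hi isWPC_intPoly).symm.toAlgHom

theorem intComp_intX (g : IntPoly D K) : intComp hi (Odot.mk 𝒮 (intX D K) g) = g := by
  rw [intComp, Odot.lift_mk]
  exact evalEquiv_symm_intX hi isWPC_intPoly g

theorem isBiringHom_intComp [Module.IsTorsionFree D (IntPoly D K ⊗[D] IntPoly D K)] :
    IsBiringHom (odotBiring 𝒮 𝒮) 𝒮 (intComp hi) where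
  map_coadd := by
    have h := hi.coadd_X
    rw [polyToInt_X] at h
    refine odot_intPoly_hom_ext hi ?_
    change Algebra.TensorProduct.map _ _ (odotCoadd 𝒮 𝒮 _) = 𝒮.coadd (intComp hi _)
    rw [odotCoadd_mk_of_primitive 𝒮 𝒮 h h, intComp_intX, h]
    simp [intComp_intX]
  map_comul := by
    have h := hi.comul_X
    rw [polyToInt_X] at h
    refine odot_intPoly_hom_ext hi ?_
    change Algebra.TensorProduct.map _ _ (odotComul 𝒮 𝒮 _) = 𝒮.comul (intComp hi _)
    rw [odotComul_mk_of_groupLike 𝒮 𝒮 h h, intComp_intX, h]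
    simp [intComp_intX]
  map_colin a := by
    have h := hi.colin_X
    rw [polyToInt_X] at h
    refine odot_intPoly_hom_ext hi ?_
    change 𝒮.colin a (intComp hi _) = odotColin 𝒮 𝒮 a _
    rw [odotColin_mk 𝒮 𝒮 a h (h a), intComp_intX, h]

/-- The plethory structure on `Int(D)` extending a biring structure under `D[X]`. -/
noncomputable def intPlethory [Module.IsTorsionFree D (IntPoly D K ⊗[D] IntPoly D K)] :
    Plethory D (IntPoly D K) where
  toBiring := 𝒮
  comp := intComp hi
  comp_isBiringHom := isBiringHom_intComp hi
  comp_assoc a b c := by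
    refine DFunLike.congr_fun
      (f := ((intComp hi).comp (Odot.mkHom 𝒮 c)).comp ((intComp hi).comp (Odot.mkHom 𝒮 b)))
      (g := (intComp hi).comp (Odot.mkHom 𝒮 _)) (intPoly_hom_ext ?_) a
    simp only [AlgHom.comp_apply, Odot.mkHom_apply, intComp_intX]
  unit := polyToInt D K
  unit_isBiringHom := hi
  unit_comp g := by rw [polyToInt_X, intComp_intX]
  comp_unit f := by
    refine DFunLike.congr_fun
      (f := (intComp hi).comp (Odot.mkHom 𝒮 _)) (g := AlgHom.id D _) (intPoly_hom_ext ?_) f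
    rw [polyToInt_X]
    exact intComp_intX hi _

end Existence

section TensorPower

theorem isTorsionFree_of_linearEquiv {R M N : Type*} [CommSemiring R] [AddCommMonoid M]
    [Module R M] [AddCommMonoid N] [Module R N] (e : M ≃ₗ[R] N) (h : Module.IsTorsionFree R N) :
    Module.IsTorsionFree R M :=
  e.injective.moduleIsTorsionFree _ e.map_smul

variable (R M : Type*) [CommSemiring R] [AddCommMonoid M] [Module R M]

/-- `M ⊗ M ≃ M ^ {⊗ 2}`. -/
noncomputable def tensorPowerTwoEquiv : M ⊗[R] M ≃ₗ[R] ⨂[R]^2 M :=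
  (TensorProduct.congr (PiTensorProduct.subsingletonEquiv (R := R) (s := fun _ : Fin 1 => M) 0).symm
    (PiTensorProduct.subsingletonEquiv (R := R) (s := fun _ : Fin 1 => M) 0).symm).trans
    TensorPower.mulEquiv

/-- `M ⊗ (M ⊗ M) ≃ M ^ {⊗ 3}`. -/
noncomputable def tensorPowerThreeEquiv : M ⊗[R] (M ⊗[R] M) ≃ₗ[R] ⨂[R]^3 M :=
  (TensorProduct.congr (PiTensorProduct.subsingletonEquiv (R := R) (s := fun _ : Fin 1 => M) 0).symm
    (tensorPowerTwoEquiv R M)).trans TensorPower.mulEquiv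

end TensorPower

theorem exists_plethory {D K : Type u} [CommRing D] [IsDomain D] [Field K] [Algebra D K]
    [IsFractionRing D K] (h : ∀ n ≤ 4, Module.IsTorsionFree D (⨂[D]^n (IntPoly D K)))
    (hw : IsWeaklyPolynomiallyComposite D K) :
    ∃ Q : Plethory D (IntPoly D K), Q.unit = polyToInt D K := by
  have := isTorsionFree_of_linearEquiv (tensorPowerTwoEquiv D (IntPoly D K)) (h 2 (by lia))
  have := isTorsionFree_of_linearEquiv (tensorPowerThreeEquiv D (IntPoly D K)) (h 3 (by lia))
  exact ⟨intPlethory (isBiringHom_intBiring (isWPC_intPoly_tensor hw)), rfl⟩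

end Pleth

theorem mainTheorem1 (D K : Type u) [CommRing D] [IsDomain D] [Field K] [Algebra D K]
    [IsFractionRing D K] :
    -- a sufficient condition for the existence of the plethory structure
    ((∀ n ≤ 4, Module.IsTorsionFree D (⨂[D]^n (Pleth.IntPoly D K))) →
      Pleth.IsWeaklyPolynomiallyComposite D K →
      ∃ Q : Pleth.Plethory D (Pleth.IntPoly D K), Q.unit = Pleth.polyToInt D K) ∧
    ∀ Q : Pleth.Plethory D (Pleth.IntPoly D K), Q.unit = Pleth.polyToInt D K →
      -- `Int(D)`-rings are WPC
      (∀ (A : Type u) [CommRing A] [Algebra D A],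
        Nonempty (Pleth.PRing Q A) → Pleth.IsWPC D K A) ∧
      -- torsion-free algebras: uniqueness and existence of `Int(D)`-ring structures
      (∀ (A : Type u) [CommRing A] [Algebra D A], Module.IsTorsionFree D A →
        Subsingleton (Pleth.PRing Q A) ∧
        (Nonempty (Pleth.PRing Q A) ↔ Pleth.IsWPC D K A)) ∧
      -- `W(A)` and `Int(D) ⊙ A` carry `Int(D)`-ring structures, hence are WPC
      (∀ (A : Type u) [CommRing A] [Algebra D A],
        Nonempty (Pleth.PRing Q (Pleth.Witt Q.toBiring A)) ∧
        Nonempty (Pleth.PRing Q (Pleth.Odot Q.toBiring A)) ∧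
        Pleth.IsWPC D K (Pleth.Witt Q.toBiring A) ∧
        Pleth.IsWPC D K (Pleth.Odot Q.toBiring A)) ∧
      -- `W` on torsion-free algebras is `w^D`
      (∀ (A : Type u) [CommRing A] [Algebra D A], Module.IsTorsionFree D A →
        IsGreatest {B : Subalgebra D A | Pleth.IsWPC D K B} (Pleth.wUpper D K A) ∧
        ∃ ev : Pleth.Witt Q.toBiring A →ₐ[D] A,
          (∀ φ, ev φ = φ.hom (Pleth.intX D K)) ∧
          Function.Injective ev ∧ ev.range = Pleth.wUpper D K A) ∧
      (∃ e : (Pleth.torsionFree D).ι ⋙ Pleth.wittFunctor Q.toBiring ≅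
          (Pleth.torsionFree D).ι ⋙ Pleth.wUpperFunctor D K,
        ∀ (A : (Pleth.torsionFree D).FullSubcategory) (φ : Pleth.Witt Q.toBiring A.obj),
          ((e.hom.app A).hom φ : Pleth.wUpper D K A.obj).1 = φ.hom (Pleth.intX D K)) ∧
      -- `T ∘ (Int(D) ⊙ -)` on torsion-free algebras is `w_D`
      (∀ (A : Type u) [CommRing A] [Algebra D A], Module.IsTorsionFree D A →
        IsLeast {B : Subalgebra D (K ⊗[D] A) |
          (Algebra.TensorProduct.includeRight : A →ₐ[D] K ⊗[D] A).range ≤ B ∧ Pleth.IsWPC D K B}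
          (Pleth.wLower D K A) ∧
        ∃ ev : Pleth.Odot Q.toBiring A →ₐ[D] K ⊗[D] A,
          (∀ (f : Pleth.IntPoly D K) (a : A),
            ev (Pleth.Odot.mk Q.toBiring f a) =
              Polynomial.aeval ((1 : K) ⊗ₜ[D] a) (f : Polynomial K)) ∧
          ev.range = Pleth.wLower D K A) ∧
      (∃ e : (Pleth.torsionFree D).ι ⋙ Pleth.odotFunctor Q.toBiring ⋙
            Pleth.torsionQuotFunctor D K ≅
          (Pleth.torsionFree D).ι ⋙ Pleth.wLowerFunctor D K,
        ∀ (A : (Pleth.torsionFree D).FullSubcategory) (f : Pleth.IntPoly D K) (a : A.obj),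
          ((e.hom.app A).hom (Pleth.toTorsionQuot D K _ (Pleth.Odot.mk Q.toBiring f a)) :
            Pleth.wLower D K A.obj).1 =
              Polynomial.aeval ((1 : K) ⊗ₜ[D] a) (f : Polynomial K)) ∧
      -- torsion-free WPC algebras are fixed by both functors
      (∀ (A : Type u) [CommRing A] [Algebra D A], Module.IsTorsionFree D A →
        Pleth.IsWPC D K A →
        (∃ ev : Pleth.Witt Q.toBiring A →ₐ[D] A,
          (∀ φ, ev φ = φ.hom (Pleth.intX D K)) ∧ Function.Bijective ev) ∧
        ∃ η : A →ₐ[D] Pleth.torsionQuot D K (Pleth.Odot Q.toBiring A),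
          (∀ a, η a =
            Pleth.toTorsionQuot D K _ (Pleth.Odot.mk Q.toBiring (Pleth.intX D K) a)) ∧
          Function.Bijective η) ∧
      -- `T ∘ (Int(D) ⊙ -)` is a left adjoint of the inclusion
      Pleth.IsLeftAdjointOfInclusion D K
        (Pleth.odotFunctor Q.toBiring ⋙ Pleth.torsionQuotFunctor D K) ∧
      -- when `W` and `Int(D) ⊙ -` are adjoints of the inclusion
      (Pleth.IsRightAdjointOfInclusion D K (Pleth.wittFunctor Q.toBiring) ∧
          Pleth.IsLeftAdjointOfInclusion D K (Pleth.odotFunctor Q.toBiring) ↔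
        ∀ (R : Type u) [CommRing R] [Algebra D R],
          Module.IsTorsionFree D (Pleth.Witt Q.toBiring R) ∧
          Module.IsTorsionFree D (Pleth.Odot Q.toBiring R)) ∧
      -- principal ideal domains with finite residue fields
      (IsPrincipalIdealRing D → (∀ m : Ideal D, m.IsMaximal → Finite (D ⧸ m)) →
        (∀ (A : Type u) [CommRing A] [Algebra D A],
          Nonempty (Pleth.PRing Q A) → Module.IsTorsionFree D A) ∧
        Pleth.IsRightAdjointOfInclusion D K (Pleth.wittFunctor Q.toBiring) ∧
        Pleth.IsLeftAdjointOfInclusion D K (Pleth.odotFunctor Q.toBiring)) := by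
  refine ⟨Pleth.exists_plethory, fun Q hQ => ?_⟩
  have hi := Pleth.isBiringHom_polyToInt hQ
  refine ⟨fun A _ _ ⟨ρ⟩ => ρ.isWPC hQ, fun A _ _ _ => ⟨Pleth.PRing.subsingleton_of_isTorsionFree hQ,
    fun ⟨ρ⟩ => ρ.isWPC hQ, fun hA => ⟨Pleth.PRing.ofIsWPC hQ hA⟩⟩, fun A _ _ =>
    ⟨⟨Pleth.PRing.witt Q A⟩, ⟨Pleth.PRing.odot Q A⟩, Pleth.isWPC_witt hQ A, Pleth.isWPC_odot hQ A⟩,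
    fun A _ _ _ => ⟨?_, Pleth.Witt.eval hi A, Pleth.eval_apply_intX hi, Pleth.eval_injective hi,
      Pleth.range_eval hQ⟩, ?_, fun A _ _ _ => ⟨Pleth.isLeast_wLower A, Pleth.odotEval hi A,
      Pleth.odotEval_mk hi, Pleth.range_odotEval hi (Pleth.isWPC_odot hQ A)⟩, ?_,
    fun A _ _ _ hA => ⟨⟨Pleth.Witt.eval hi A, Pleth.eval_apply_intX hi, Pleth.eval_injective hi,
      (Pleth.eval_surjective_iff hi).2 hA⟩, _,
      fun a => congrArg (Pleth.toTorsionQuot D K _) (Pleth.odotUnit_apply hi a),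
      Pleth.toTorsionQuot_odotUnit_bijective hQ hA⟩,
    Pleth.isLeftAdjointOfInclusion_torsionQuot_odot hQ, ⟨fun h R _ _ =>
      ⟨(h.1.1 (CommAlgCat.of D R)).1, (h.2.1 (CommAlgCat.of D R)).1⟩, fun h =>
      ⟨Pleth.isRightAdjointOfInclusion_witt hQ fun R _ _ => (h R).1,
        Pleth.isLeftAdjointOfInclusion_odot hQ fun R _ _ => (h R).2⟩⟩, fun _ hD =>
    ⟨fun A _ _ ⟨ρ⟩ => ρ.isTorsionFree hQ hD,
      Pleth.isRightAdjointOfInclusion_witt hQ fun R _ _ =>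
        (Pleth.PRing.witt Q R).isTorsionFree hQ hD,
      Pleth.isLeftAdjointOfInclusion_odot hQ fun R _ _ =>
        (Pleth.PRing.odot Q R).isTorsionFree hQ hD⟩⟩
  · rw [← Pleth.range_eval hQ]
    exact Pleth.range_eval_isGreatest hQ
  · exact Pleth.exists_wittFunctor_iso_wUpperFunctor hQ
  · exact Pleth.exists_odotFunctor_iso_wLowerFunctor hQ
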